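/- Let $\mathbb{F}$ be $\mathbb{R}$ or $\mathbb{C}$. A \emph{normalized convex Orlicz function} is a convex function $M\colon[0,\infty)\to[0,\infty)$ with $M(0)=0$ and $M(1)=1$; it is \emph{degenerate} if it vanishes in a neighborhood of the origin of $[0,\infty)$. The Orlicz sequence space $\ell_M$ consists of all sequences $f=(a_n)_{n=1}^\infty\in\mathbb{F}^{\mathbb{N}}$ with finite Luxemburg norm $$\Vert f\Vert_{\ell_M}=\inf\Big\{t>0\colon \sum_{n=1}^\infty M\big(|a_n|/t\big)\le 1\Big\}.$$ For a non-degenerate normalized convex Orlicz function $M$ and $b>0$ put $M_b(t)=M(bt)/M(b)$ for $t\ge0$, and define, with the convention $\inf\emptyset=\infty$, $$\alpha_M=\sup\Big\{q\in[1,\infty)\colon \sup_{0<b,t\le1}t^{-q}M_b(t)<\infty\Big\},\qquad \beta_M=\inf\Big\{q\in[1,\infty)\colon \inf_{0<b,t\le1}t^{-q}M_b(t)>0\Big\}.$$ The support of $f=(a_n)_{n=1}^\infty\in\ell_M$ is $\operatorname{supp}(f)=\{n\colon a_n\ne0\}$. A sequence $(f_n)_{n=1}^\infty$ in $\ell_M$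 is \emph{disjointly supported} if the sets $\operatorname{supp}(f_n)$ are pairwise disjoint; it is a \emph{block basic sequence} if there are integers $0=k_0<k_1<k_2<\cdots$ with $\operatorname{supp}(f_n)\subseteq[1+k_{n-1},k_n]$ for every $n\in\mathbb{N}$. Two sequences $(x_j)_{j=1}^\infty$ and $(y_j)_{j=1}^\infty$ in normed spaces over $\mathbb{F}$ are \emph{equivalent} if there is a constant $C<\infty$ such that $\Vert\sum_j a_jx_j\Vert\le C\Vert\sum_j a_jy_j\Vert$ and $\Vert\sum_j a_jy_j\Vert\le C\Vert\sum_j a_jx_j\Vert$ for every finitely supported scalar sequence $(a_j)_{j=1}^\infty$. \textbf{Theorem.} Let $M$ be a non-degenerate normalized convex Orlicz function and let $1\le p\le\infty$. The following are equivalent. (a) $p\in[\alpha_M,\beta_M]$. (b) There is a disjointly supported sequence in $\ell_M$ that is equivalent to the unit vector system of $\ell_p$. (c) There is a block basic sequence in $\ell_M$ (with respect to its unit vector system) that is equivalent to the unit vector system of $\ell_p$. -/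

import Mathlib

open scoped NNReal ENNReal Topology

/-- A normalized convex Orlicz function: a convex map `M : [0,∞) → [0,∞)`
with `M 0 = 0` and `M 1 = 1`. -/
structure OrliczFunction where
  toFun : ℝ≥0 → ℝ≥0
  convex' : ConvexOn ℝ≥0 Set.univ toFun
  map_zero' : toFun 0 = 0
  map_one' : toFun 1 = 1

namespace OrliczFunction

instance : CoeFun OrliczFunction (fun _ => ℝ≥0 → ℝ≥0) := ⟨toFun⟩

/-- `M` is degenerate if it vanishes in a neighbourhood of the origin of `[0,∞)`. -/
def IsDegenerate (M : OrliczFunction) : Prop := ∀ᶠ t in 𝓝 (0 : ℝ≥0), M t = 0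

/-- The dilated and normalized function `M_b(t) = M(bt) / M(b)`. -/
noncomputable def dilate (M : OrliczFunction) (b t : ℝ≥0) : ℝ≥0 := M (b * t) / M b

/-- The index `α_M`, the supremum (in `[0,∞]`) of all `q ∈ [1,∞)` such that
`sup {t^{-q} M_b(t) : 0 < b, t ≤ 1} < ∞`. -/
noncomputable def lowerIndex (M : OrliczFunction) : ℝ≥0∞ :=
  sSup ((fun q : ℝ≥0 => (q : ℝ≥0∞)) '' {q : ℝ≥0 | 1 ≤ q ∧
    (⨆ b ∈ Set.Ioc (0 : ℝ≥0) 1, ⨆ t ∈ Set.Ioc (0 : ℝ≥0) 1,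
      ((t ^ (-(q : ℝ)) * M.dilate b t : ℝ≥0) : ℝ≥0∞)) < ∞})

/-- The index `β_M`, the infimum (in `[0,∞]`, so that `inf ∅ = ∞`) of all `q ∈ [1,∞)` such that
`inf {t^{-q} M_b(t) : 0 < b, t ≤ 1} > 0`. -/
noncomputable def upperIndex (M : OrliczFunction) : ℝ≥0∞ :=
  sInf ((fun q : ℝ≥0 => (q : ℝ≥0∞)) '' {q : ℝ≥0 | 1 ≤ q ∧
    0 < (⨅ b ∈ Set.Ioc (0 : ℝ≥0) 1, ⨅ t ∈ Set.Ioc (0 : ℝ≥0) 1,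
      ((t ^ (-(q : ℝ)) * M.dilate b t : ℝ≥0) : ℝ≥0∞))})

theorem le_smul (M : OrliczFunction) {a : ℝ≥0} (ha : a ≤ 1) (x : ℝ≥0) : M (a * x) ≤ a * M x := by
  have h := M.convex'.2 (Set.mem_univ x) (Set.mem_univ (0 : ℝ≥0)) (zero_le (a := a))
    (zero_le (a := 1 - a)) (add_tsub_cancel_of_le ha)
  simpa [M.map_zero'] using h

theorem mono (M : OrliczFunction) : Monotone M.toFun := by
  intro x y hxy
  rcases eq_or_ne y 0 with rfl | hy
  · rw [nonpos_iff_eq_zero.mp hxy]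
  · have h1 : x / y ≤ 1 := div_le_one_of_le₀ hxy zero_le
    have h := M.le_smul h1 y
    rw [div_mul_cancel₀ _ hy] at h
    exact h.trans (mul_le_of_le_one_left zero_le h1)

theorem le_one_of_map_le_one (M : OrliczFunction) {y : ℝ≥0} (h : M y ≤ 1) : y ≤ 1 := by
  by_contra! hy
  have hy0 : y ≠ 0 := (zero_lt_one.trans hy).ne'
  have h2 := M.le_smul (inv_le_one_of_one_le₀ hy.le) y
  rw [inv_mul_cancel₀ hy0, M.map_one'] at h2
  have h3 : y⁻¹ * M y ≤ y⁻¹ * 1 := by gcongr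
  have h4 : y⁻¹ < 1 := inv_lt_one_of_one_lt₀ hy
  rw [mul_one] at h3
  exact absurd (h2.trans h3) (not_le.mpr h4)

variable {𝕜 : Type*} [RCLike 𝕜]

/-- The modular `m_M(f) = ∑ₙ M(|f n|)`, with values in `[0,∞]`. -/
noncomputable def modular (M : OrliczFunction) (f : ℕ → 𝕜) : ℝ≥0∞ :=
  ∑' n, (M ‖f n‖₊ : ℝ≥0∞)

/-- The Luxemburg norm `inf {t > 0 : m_M(f / t) ≤ 1}`, with values in `[0,∞]`. -/
noncomputable def luxemburg (M : OrliczFunction) (f : ℕ → 𝕜) : ℝ≥0∞ :=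
  sInf ((fun t : ℝ≥0 => (t : ℝ≥0∞)) ''
    {t : ℝ≥0 | 0 < t ∧ M.modular (fun n => f n / ((t : ℝ) : 𝕜)) ≤ 1})

theorem luxemburg_le (M : OrliczFunction) {f : ℕ → 𝕜} {t : ℝ≥0} (ht : 0 < t)
    (h : M.modular (fun n => f n / ((t : ℝ) : 𝕜)) ≤ 1) : M.luxemburg f ≤ t :=
  sInf_le ⟨t, ⟨ht, h⟩, rfl⟩

theorem exists_of_luxemburg_lt (M : OrliczFunction) {f : ℕ → 𝕜} {r : ℝ≥0∞}
    (h : M.luxemburg f < r) : ∃ t : ℝ≥0, (t : ℝ≥0∞) < r ∧ 0 < t ∧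
      M.modular (fun n => f n / ((t : ℝ) : 𝕜)) ≤ 1 := by
  obtain ⟨_, ⟨t, ht, rfl⟩, hr⟩ := sInf_lt_iff.mp h
  exact ⟨t, hr, ht.1, ht.2⟩

theorem nnnorm_div_coe (x : 𝕜) (t : ℝ≥0) : ‖x / ((t : ℝ) : 𝕜)‖₊ = ‖x‖₊ / t := by
  ext
  simp

theorem luxemburg_zero (M : OrliczFunction) : M.luxemburg (0 : ℕ → 𝕜) = 0 := by
  refine le_antisymm (ENNReal.le_of_forall_pos_le_add fun ε hε _ => ?_) zero_le
  rw [zero_add]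
  refine M.luxemburg_le hε ?_
  simp [modular, M.map_zero']

theorem nnnorm_le_luxemburg (M : OrliczFunction) (f : ℕ → 𝕜) (n : ℕ) :
    (‖f n‖₊ : ℝ≥0∞) ≤ M.luxemburg f := by
  refine le_sInf ?_
  rintro _ ⟨t, ⟨ht, h⟩, rfl⟩
  have h1 := (ENNReal.le_tsum n).trans h
  rw [nnnorm_div_coe] at h1
  have h2 := M.le_one_of_map_le_one (ENNReal.coe_le_one_iff.mp h1)
  exact ENNReal.coe_le_coe.mpr ((div_le_one ht).mp h2)

theorem luxemburg_add_le (M : OrliczFunction) (f g : ℕ → 𝕜) :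
    M.luxemburg (f + g) ≤ M.luxemburg f + M.luxemburg g := by
  refine ENNReal.le_of_forall_pos_le_add fun ε hε hlt => ?_
  have hf : M.luxemburg f ≠ ∞ := (lt_of_le_of_lt le_self_add hlt).ne
  have hg : M.luxemburg g ≠ ∞ := (lt_of_le_of_lt le_add_self hlt).ne
  have hε2 : ((ε / 2 : ℝ≥0) : ℝ≥0∞) ≠ 0 := by
    rw [ENNReal.coe_ne_zero]; exact (half_pos hε).ne'
  obtain ⟨s, hs, hs0, hsm⟩ := M.exists_of_luxemburg_lt (ENNReal.lt_add_right hf hε2)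
  obtain ⟨t, ht, ht0, htm⟩ := M.exists_of_luxemburg_lt (ENNReal.lt_add_right hg hε2)
  have hst : 0 < s + t := add_pos hs0 ht0
  have key : M.modular (fun n => (f + g) n / (((s + t : ℝ≥0) : ℝ) : 𝕜)) ≤ 1 := by
    have hab : s / (s + t) + t / (s + t) = 1 := by
      rw [← add_div, div_self hst.ne']
    have hn : ∀ n, (M ‖(f + g) n / (((s + t : ℝ≥0) : ℝ) : 𝕜)‖₊ : ℝ≥0∞) ≤
        ((s / (s + t) : ℝ≥0) : ℝ≥0∞) * (M ‖f n / ((s : ℝ) : 𝕜)‖₊ : ℝ≥0∞) +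
        ((t / (s + t) : ℝ≥0) : ℝ≥0∞) * (M ‖g n / ((t : ℝ) : 𝕜)‖₊ : ℝ≥0∞) := by
      intro n
      norm_cast
      rw [nnnorm_div_coe, nnnorm_div_coe, nnnorm_div_coe]
      have h1 : ‖(f + g) n‖₊ / (s + t) ≤
          (s / (s + t)) • (‖f n‖₊ / s) + (t / (s + t)) • (‖g n‖₊ / t) := by
        have e : (s / (s + t)) • (‖f n‖₊ / s) + (t / (s + t)) • (‖g n‖₊ / t)
            = (‖f n‖₊ + ‖g n‖₊) / (s + t) := by
          have := hs0.ne'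
          have := ht0.ne'
          have := hst.ne'
          simp only [smul_eq_mul]
          field_simp
        rw [e]
        gcongr
        exact nnnorm_add_le _ _
      exact (M.mono h1).trans
        (M.convex'.2 (Set.mem_univ _) (Set.mem_univ _) zero_le zero_le hab)
    refine (ENNReal.tsum_le_tsum hn).trans ?_
    rw [ENNReal.tsum_add, ENNReal.tsum_mul_left, ENNReal.tsum_mul_left]
    calc _ ≤ ((s / (s + t) : ℝ≥0) : ℝ≥0∞) * 1 + ((t / (s + t) : ℝ≥0) : ℝ≥0∞) * 1 := by
          gcongr
          · exact hsm
          · exact htm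
      _ = 1 := by
          rw [mul_one, mul_one, ← ENNReal.coe_add, hab, ENNReal.coe_one]
  calc M.luxemburg (f + g) ≤ ((s + t : ℝ≥0) : ℝ≥0∞) := M.luxemburg_le hst key
    _ = (s : ℝ≥0∞) + t := ENNReal.coe_add _ _
    _ ≤ (M.luxemburg f + (ε / 2 : ℝ≥0)) + (M.luxemburg g + (ε / 2 : ℝ≥0)) :=
        add_le_add hs.le ht.le
    _ = M.luxemburg f + M.luxemburg g + ((ε / 2 + ε / 2 : ℝ≥0) : ℝ≥0∞) := by
        rw [ENNReal.coe_add]; ring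
    _ = _ := by rw [add_halves]

theorem luxemburg_smul_le (M : OrliczFunction) (c : 𝕜) (f : ℕ → 𝕜) :
    M.luxemburg (c • f) ≤ (‖c‖₊ : ℝ≥0∞) * M.luxemburg f := by
  rcases eq_or_ne c 0 with rfl | hc
  · simp [luxemburg_zero]
  have hc' : 0 < ‖c‖₊ := nnnorm_pos.mpr hc
  have hc0 : (‖c‖₊ : ℝ≥0∞) ≠ 0 := ENNReal.coe_ne_zero.mpr hc'.ne'
  rw [mul_comm, ← ENNReal.div_le_iff hc0 ENNReal.coe_ne_top]
  refine le_sInf ?_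
  rintro _ ⟨t, ⟨ht, h⟩, rfl⟩
  rw [ENNReal.div_le_iff hc0 ENNReal.coe_ne_top]
  have h2 := M.luxemburg_le (f := c • f) (mul_pos ht hc') (by
    refine le_of_eq_of_le ?_ h
    simp only [modular, nnnorm_div_coe, Pi.smul_apply, nnnorm_smul]
    refine tsum_congr fun n => ?_
    rw [mul_comm t, mul_div_mul_left _ _ hc'.ne'])
  simpa using h2

/-- The sequences of finite Luxemburg norm. -/
def finiteNorm (𝕜 : Type*) [RCLike 𝕜] (M : OrliczFunction) : Submodule 𝕜 (ℕ → 𝕜) where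
  carrier := {f | M.luxemburg f < ∞}
  add_mem' hf hg := (M.luxemburg_add_le _ _).trans_lt (ENNReal.add_lt_top.mpr ⟨hf, hg⟩)
  zero_mem' := by simp [luxemburg_zero]
  smul_mem' c _ hf := (M.luxemburg_smul_le c _).trans_lt (ENNReal.mul_lt_top ENNReal.coe_lt_top hf)

end OrliczFunction

/-- The Orlicz sequence space `ℓ_M` over `𝕜`. It is a type synonym, so that it carries the topology
of the Luxemburg norm and not the one of pointwise convergence. -/
def OrliczSpace (𝕜 : Type*) [RCLike 𝕜] (M : OrliczFunction) : Type _ := M.finiteNorm 𝕜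

namespace OrliczSpace

variable {𝕜 : Type*} [RCLike 𝕜] {M : OrliczFunction}

instance : AddCommGroup (OrliczSpace 𝕜 M) := inferInstanceAs (AddCommGroup (M.finiteNorm 𝕜))

instance : Module 𝕜 (OrliczSpace 𝕜 M) := inferInstanceAs (Module 𝕜 (M.finiteNorm 𝕜))

/-- The sequence of coordinates of an element of `ℓ_M`. -/
def coord (f : OrliczSpace 𝕜 M) : ℕ → 𝕜 := f.1

theorem luxemburg_ne_top (f : OrliczSpace 𝕜 M) : M.luxemburg f.coord ≠ ∞ := f.2.ne

/-- The Luxemburg norm makes `ℓ_M` a normed space. -/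
noncomputable instance : NormedAddCommGroup (OrliczSpace 𝕜 M) :=
  AddGroupNorm.toNormedAddCommGroup
    { toFun := fun f => (M.luxemburg f.coord).toReal
      map_zero' := by
        change (M.luxemburg (0 : ℕ → 𝕜)).toReal = 0
        rw [M.luxemburg_zero, ENNReal.toReal_zero]
      add_le' := fun f g => by
        rw [← ENNReal.toReal_add f.luxemburg_ne_top g.luxemburg_ne_top]
        exact ENNReal.toReal_mono
          (ENNReal.add_ne_top.mpr ⟨f.luxemburg_ne_top, g.luxemburg_ne_top⟩)
          (M.luxemburg_add_le f.coord g.coord)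
      neg' := fun f => by
        change (M.luxemburg (-f.coord)).toReal = _
        simp only [OrliczFunction.luxemburg, OrliczFunction.modular,
          OrliczFunction.nnnorm_div_coe, Pi.neg_apply, nnnorm_neg]
      eq_zero_of_map_eq_zero' := fun f hf => by
        have h0 : M.luxemburg f.coord = 0 :=
          ((ENNReal.toReal_eq_zero_iff _).mp hf).resolve_right f.luxemburg_ne_top
        refine Subtype.ext (funext fun n => ?_)
        have h1 := M.nnnorm_le_luxemburg f.coord n
        rw [h0, nonpos_iff_eq_zero, ENNReal.coe_eq_zero, nnnorm_eq_zero] at h1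
        exact h1 }

theorem norm_def (f : OrliczSpace 𝕜 M) : ‖f‖ = (M.luxemburg f.coord).toReal := rfl

noncomputable instance : NormedSpace 𝕜 (OrliczSpace 𝕜 M) where
  norm_smul_le c f := by
    have h := ENNReal.toReal_mono (ENNReal.mul_ne_top ENNReal.coe_ne_top f.luxemburg_ne_top)
      (M.luxemburg_smul_le c f.coord)
    rwa [ENNReal.toReal_mul] at h

/-- The support of `f` with respect to the unit vector system. -/
def supp (f : OrliczSpace 𝕜 M) : Set ℕ := {j | f.coord j ≠ 0}

/-- The supports of the members of the sequence are pairwise disjoint. -/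
def DisjointlySupported (f : ℕ → OrliczSpace 𝕜 M) : Prop :=
  Pairwise fun m n => Disjoint (f m).supp (f n).supp

/-- The supports of the members of the sequence are contained in consecutive finite intervals
`[k n, k (n+1))` of indices (the indices start at `0`). Nonzero members are not part of this
definition: they follow when the sequence is equivalent to another basic sequence. -/
def IsBlockSequence (f : ℕ → OrliczSpace 𝕜 M) : Prop :=
  ∃ k : ℕ → ℕ, k 0 = 0 ∧ StrictMono k ∧ ∀ n, (f n).supp ⊆ Set.Ico (k n) (k (n + 1))

end OrliczSpace

/-- Equivalence of sequences: for a constant `C`, the norms of `∑ aⱼ xⱼ` and of `∑ aⱼ yⱼ` are within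
the factor `C` of each other for all finitely supported scalar sequences `a`. -/
def EquivalentSequences (𝕜 : Type*) [RCLike 𝕜] {X Y : Type*}
    [NormedAddCommGroup X] [NormedSpace 𝕜 X] [NormedAddCommGroup Y] [NormedSpace 𝕜 Y]
    (x : ℕ → X) (y : ℕ → Y) : Prop :=
  ∃ C : ℝ, ∀ a : ℕ →₀ 𝕜,
    ‖a.sum fun j c => c • x j‖ ≤ C * ‖a.sum fun j c => c • y j‖ ∧
    ‖a.sum fun j c => c • y j‖ ≤ C * ‖a.sum fun j c => c • x j‖

/-- The unit vector system of `ℓ_p`. -/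
noncomputable def lpUnitVector (𝕜 : Type*) [RCLike 𝕜] (p : ℝ≥0∞) (n : ℕ) :
    lp (fun _ : ℕ => 𝕜) p :=
  lp.single p n 1

/-! ### The indices as power inequalities for `M` -/

namespace OrliczFunction

/-! For disjointly supported vectors the modular is additive, so the span of `f` is governed by the
functions `x ↦ (f n).modularAt x`. Everything reduces to comparing these functions with `x ^ p` on
`[0, 1]`.

Sufficiency, `p < ∞`. If `α_M ≤ p ≤ β_M`, then for every `δ > 0` the function `M` decreases towards
the origin somewhere much more slowly than `t ^ (p + δ)` (`exists_growth`) and, closer to the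
origin, somewhere much faster than `t ^ (p - δ)` (`exists_decay`). Hence, after multiplication by a
slowly varying tent weight, `M (2⁻¹ ^ s) * 2 ^ (p * s)` has an interior value dominating both ends
of a window of exponents `s`. Shifting such a window by a bounded amount hardly changes the sum over
it, and this near invariance says that an integer combination of dilates of `M` reproduces `x ^ p`
at the dyadic points, with an absolute constant (`exists_dyadic_combination`). The combination is
the modular of a finite block. Blocks with errors `2⁻¹ ^ (n + 1)` span a copy of `ℓ_p`, since the
errors are summable (`DisjointlySupported.equivalent_lp`).

Sufficiency, `p = ∞`. When `β_M = ∞`, some ratio `M (t / 2) / M t` is as small as desired, and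
repeating the value `t` about `1 / M t` times gives a block with modular at least `1` at `1` and
almost `0` at `1 / 2` (`exists_sup_block`).

Necessity. A power estimate for `M` with exponent `q` passes to the modulars of the `f n`, hence
bounds the norm of a sum of `N` of them by a multiple of `N ^ (1 / q)`, from above if `p < q < α_M`
and from below if `β_M < q < p`. In `ℓ_p` this norm is `N ^ (1 / p)`, a contradiction as `N → ∞`. -/

theorem map_pos (M : OrliczFunction) (hM : ¬ M.IsDegenerate) {t : ℝ≥0} (ht : 0 < t) : 0 < M t := by
  by_contra h
  refine hM ?_
  filter_upwards [Iio_mem_nhds ht] with s hs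
  exact le_antisymm ((M.mono (le_of_lt hs)).trans (not_lt.mp h)) zero_le

theorem le_lowerIndex (M : OrliczFunction) (hM : ¬ M.IsDegenerate) {q K : ℝ≥0} (hq : 1 ≤ q)
    (h : ∀ b t : ℝ≥0, 0 < b → b ≤ 1 → 0 < t → t ≤ 1 → M (b * t) ≤ K * t ^ (q : ℝ) * M b) :
    (q : ℝ≥0∞) ≤ M.lowerIndex := by
  refine le_sSup ⟨q, ⟨hq, lt_of_le_of_lt ?_ (ENNReal.coe_lt_top (r := K))⟩, rfl⟩
  refine iSup₂_le fun b hb => iSup₂_le fun t ht => ?_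
  rw [ENNReal.coe_le_coe, dilate, NNReal.rpow_neg, ← div_eq_inv_mul, div_div,
    div_le_iff₀ (mul_pos (M.map_pos hM hb.1) (NNReal.rpow_pos ht.1))]
  exact (h b t hb.1 hb.2 ht.1 ht.2).trans_eq (by ring)

theorem upperIndex_le (M : OrliczFunction) (hM : ¬ M.IsDegenerate) {q c : ℝ≥0} (hq : 1 ≤ q)
    (hc : 0 < c)
    (h : ∀ b t : ℝ≥0, 0 < b → b ≤ 1 → 0 < t → t ≤ 1 → c * t ^ (q : ℝ) * M b ≤ M (b * t)) :
    M.upperIndex ≤ q := by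
  refine sInf_le ⟨q, ⟨hq, lt_of_lt_of_le (ENNReal.coe_pos.mpr hc) ?_⟩, rfl⟩
  refine le_iInf₂ fun b hb => le_iInf₂ fun t ht => ?_
  rw [ENNReal.coe_le_coe, dilate, NNReal.rpow_neg, ← div_eq_inv_mul, div_div,
    le_div_iff₀ (mul_pos (M.map_pos hM hb.1) (NNReal.rpow_pos ht.1))]
  exact (h b t hb.1 hb.2 ht.1 ht.2).trans_eq' (by ring)

theorem exists_of_lt_lowerIndex (M : OrliczFunction) (hM : ¬ M.IsDegenerate) {p : ℝ≥0∞}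
    (hp : p < M.lowerIndex) : ∃ q K : ℝ≥0, p < q ∧ 1 ≤ q ∧
      ∀ b t : ℝ≥0, 0 < b → b ≤ 1 → 0 < t → t ≤ 1 → M (b * t) ≤ K * t ^ (q : ℝ) * M b := by
  obtain ⟨_, ⟨q, ⟨hq, hfin⟩, rfl⟩, hpq⟩ := lt_sSup_iff.mp hp
  obtain ⟨K, hK, -⟩ := ENNReal.lt_iff_exists_nnreal_btwn.mp hfin
  refine ⟨q, K, hpq, hq, fun b t hb0 hb1 ht0 ht1 => ?_⟩
  have h := (le_iSup₂ (f := fun b (_ : b ∈ Set.Ioc (0 : ℝ≥0) 1) =>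
      ⨆ t ∈ Set.Ioc (0 : ℝ≥0) 1, ((t ^ (-(q : ℝ)) * M.dilate b t : ℝ≥0) : ℝ≥0∞)) b
      ⟨hb0, hb1⟩).trans hK.le
  have h2 := (le_iSup₂ (f := fun t (_ : t ∈ Set.Ioc (0 : ℝ≥0) 1) =>
      ((t ^ (-(q : ℝ)) * M.dilate b t : ℝ≥0) : ℝ≥0∞)) t ⟨ht0, ht1⟩).trans h
  rw [ENNReal.coe_le_coe, dilate, NNReal.rpow_neg, ← div_eq_inv_mul, div_div,
    div_le_iff₀ (mul_pos (M.map_pos hM hb0) (NNReal.rpow_pos ht0))] at h2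
  exact h2.trans_eq (by ring)

theorem exists_of_upperIndex_lt (M : OrliczFunction) (hM : ¬ M.IsDegenerate) {p : ℝ≥0∞}
    (hp : M.upperIndex < p) : ∃ q c : ℝ≥0, q < p ∧ 1 ≤ q ∧ 0 < c ∧
      ∀ b t : ℝ≥0, 0 < b → b ≤ 1 → 0 < t → t ≤ 1 → c * t ^ (q : ℝ) * M b ≤ M (b * t) := by
  obtain ⟨_, ⟨q, ⟨hq, hpos⟩, rfl⟩, hpq⟩ := sInf_lt_iff.mp hp
  obtain ⟨c, hc0, hc⟩ := ENNReal.lt_iff_exists_nnreal_btwn.mp hpos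
  refine ⟨q, c, hpq, hq, ENNReal.coe_pos.mp hc0, fun b t hb0 hb1 ht0 ht1 => ?_⟩
  have h := hc.le.trans (iInf₂_le (f := fun b (_ : b ∈ Set.Ioc (0 : ℝ≥0) 1) =>
      ⨅ t ∈ Set.Ioc (0 : ℝ≥0) 1, ((t ^ (-(q : ℝ)) * M.dilate b t : ℝ≥0) : ℝ≥0∞)) b ⟨hb0, hb1⟩)
  have h2 := h.trans (iInf₂_le (f := fun t (_ : t ∈ Set.Ioc (0 : ℝ≥0) 1) =>
      ((t ^ (-(q : ℝ)) * M.dilate b t : ℝ≥0) : ℝ≥0∞)) t ⟨ht0, ht1⟩)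
  rw [ENNReal.coe_le_coe, dilate, NNReal.rpow_neg, ← div_eq_inv_mul, div_div,
    le_div_iff₀ (mul_pos (M.map_pos hM hb0) (NNReal.rpow_pos ht0))] at h2
  exact h2.trans_eq' (by ring)

/-- The values `M (2⁻ᵏ)`. -/
noncomputable def dyadic (M : OrliczFunction) (k : ℕ) : ℝ := M (2⁻¹ ^ k)

theorem dyadic_nonneg (M : OrliczFunction) (k : ℕ) : 0 ≤ M.dyadic k := NNReal.coe_nonneg _

theorem dyadic_pos (M : OrliczFunction) (hM : ¬ M.IsDegenerate) (k : ℕ) : 0 < M.dyadic k :=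
  NNReal.coe_pos.mpr (M.map_pos hM (by positivity))

theorem dyadic_add_le (M : OrliczFunction) (k n : ℕ) :
    M.dyadic (k + n) ≤ 2⁻¹ ^ n * M.dyadic k := by
  have h := M.le_smul (a := 2⁻¹ ^ n) (pow_le_one₀ zero_le (by norm_num)) (2⁻¹ ^ k)
  rw [← pow_add, add_comm n k] at h
  exact_mod_cast h

theorem dyadic_antitone (M : OrliczFunction) : Antitone M.dyadic := fun _ _ h =>
  NNReal.coe_le_coe.mpr (M.mono (pow_le_pow_of_le_one zero_le (by norm_num) h))

theorem dyadic_zero (M : OrliczFunction) : M.dyadic 0 = 1 := by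
  simp [dyadic, M.map_one']

end OrliczFunction

/-! ### Oscillation of `M` along the dyadic points -/

/-- Only finitely many starting points are missing, and each costs one factor `u (S + 1) / u S`.
This lets the oscillation lemmas below be found beyond any prescribed `S`. -/
theorem exists_bound_of_eventual_bound {u : ℕ → ℝ} (hu : ∀ n, 0 < u n) (S : ℕ) (L : ℝ)
    (h : ∀ A B, S ≤ A → A ≤ B → u B ≤ L * u A) :
    ∃ K : ℝ≥0, 0 < K ∧ ∀ A B, A ≤ B → u B ≤ K * u A := by
  induction S generalizing L with
  | zero =>
    refine ⟨⟨max L 1, by positivity⟩, ?_, fun A B hAB => (h A B A.zero_le hAB).trans ?_⟩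
    · exact NNReal.coe_pos.mp (lt_max_of_lt_right one_pos)
    · exact mul_le_mul_of_nonneg_right (le_max_left _ _) (hu A).le
  | succ S ih =>
    refine ih (max (max L 1) (L * u (S + 1) / u S)) fun A B hA hAB => ?_
    rcases hA.eq_or_lt with rfl | hA
    · rcases hAB.eq_or_lt with rfl | hB
      · exact le_mul_of_one_le_left (hu _).le (by simp)
      · refine (h (S + 1) B le_rfl hB).trans ?_
        rw [← div_le_iff₀ (hu S)]
        exact le_max_right _ _
    · refine (h A B hA hAB).trans (mul_le_mul_of_nonneg_right ?_ (hu A).le)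
      simp

namespace OrliczFunction

/-- Otherwise `M.dyadic k * (2 ^ q) ^ k` would be decreasing up to a constant. Interpolating between
dyadic points, at the cost of factors `2 ^ q`, this makes `q` admissible in the supremum defining
`α_M`. -/
theorem exists_growth (M : OrliczFunction) (hM : ¬ M.IsDegenerate) {q : ℝ} (hq : 1 ≤ q)
    (hpq : M.lowerIndex < ENNReal.ofReal q) (S : ℕ) (L : ℝ) :
    ∃ A B, S ≤ A ∧ A ≤ B ∧
      L * (M.dyadic A * ((2 : ℝ) ^ q) ^ A) < M.dyadic B * ((2 : ℝ) ^ q) ^ B := by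
  by_contra! hcon
  obtain ⟨K, hK0, hK⟩ := exists_bound_of_eventual_bound
    (u := fun k => M.dyadic k * ((2 : ℝ) ^ q) ^ k)
    (fun k => mul_pos (M.dyadic_pos hM k) (by positivity)) S L hcon
  refine hpq.not_ge (M.le_lowerIndex hM (q := q.toNNReal)
    (K := (K + 1) * 2 ^ (q.toNNReal : ℝ) * 2 ^ (q.toNNReal : ℝ))
    (by rwa [Real.one_le_toNNReal]) fun b t hb0 hb1 ht0 ht1 => ?_)
  have hqq : (q.toNNReal : ℝ) = q := Real.coe_toNNReal q (by linarith)
  rw [hqq]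
  obtain ⟨i, hi1, hi2⟩ := exists_nat_pow_near_of_lt_one hb0 hb1 (y := (2⁻¹ : ℝ≥0)) (by simp)
    (by norm_num)
  obtain ⟨j, hj1, hj2⟩ := exists_nat_pow_near_of_lt_one ht0 ht1 (y := (2⁻¹ : ℝ≥0)) (by simp)
    (by norm_num)
  rw [← NNReal.coe_le_coe]
  push_cast
  set r : ℝ := (2 : ℝ) ^ q with hr
  have hr1 : 1 ≤ r := Real.one_le_rpow (by norm_num) (by linarith)
  have htq : (r ^ (j + 1))⁻¹ ≤ (t : ℝ) ^ q := by
    have h1 : ((2⁻¹ : ℝ) ^ (j + 1)) ^ q ≤ (t : ℝ) ^ q :=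
      Real.rpow_le_rpow (by positivity) (by exact_mod_cast hj1.le) (by linarith)
    rwa [← Real.rpow_natCast, ← Real.rpow_mul (by norm_num), mul_comm, Real.rpow_mul (by norm_num),
      Real.inv_rpow (by norm_num), Real.rpow_natCast, inv_pow] at h1
  have hMb : (0 : ℝ) < M b := NNReal.coe_pos.mpr (M.map_pos hM hb0)
  have hK0' : (0 : ℝ) < K := hK0
  -- Monotonicity compares `M (b * t)` with exponent `i + j` and `M b` with exponent `i + 1`; these
  -- are in the right order only if `j ≥ 1`. For `j = 0`, `t > 1 / 2` and the bound is trivial.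
  rcases Nat.eq_zero_or_pos j with rfl | hj
  · have h1 : (M (b * t) : ℝ) ≤ M b := M.mono (mul_le_of_le_one_right zero_le ht1)
    refine h1.trans (le_mul_of_one_le_left hMb.le ?_)
    have h2 : 1 ≤ r * (t : ℝ) ^ q := by
      calc 1 = r * (r ^ (0 + 1))⁻¹ := by rw [zero_add, pow_one, mul_inv_cancel₀ (by positivity)]
        _ ≤ _ := by gcongr
    calc (1 : ℝ) ≤ ((K + 1) * r) * (r * (t : ℝ) ^ q) :=
          one_le_mul_of_one_le_of_one_le (one_le_mul_of_one_le_of_one_le (by linarith) hr1) h2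
      _ = _ := by ring
  · have h1 : (M (b * t) : ℝ) ≤ M.dyadic (i + j) := by
      refine M.mono ?_
      rw [pow_add]
      gcongr
    have h2 : M.dyadic (i + 1) ≤ M b := M.mono hi1.le
    have h3 := hK (i + 1) (i + j) (by omega)
    obtain ⟨l, rfl⟩ : ∃ l, j = l + 1 := ⟨j - 1, by omega⟩
    have h4 : M.dyadic (i + (l + 1)) * r ^ l ≤ K * M.dyadic (i + 1) := by
      have e1 : r ^ (i + (l + 1)) = r ^ l * r ^ (i + 1) := by ring
      rw [e1] at h3
      exact le_of_mul_le_mul_right (by linarith) (show 0 < r ^ (i + 1) by positivity)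
    calc (M (b * t) : ℝ) ≤ M.dyadic (i + (l + 1)) := h1
      _ = M.dyadic (i + (l + 1)) * r ^ l * r * r * (r ^ (l + 1 + 1))⁻¹ := by field_simp; ring
      _ ≤ (K * M.dyadic (i + 1)) * r * r * (t : ℝ) ^ q := by
          have := M.dyadic_nonneg (i + 1)
          gcongr
      _ ≤ ((K + 1) * M b) * r * r * (t : ℝ) ^ q := by
          have := M.dyadic_nonneg (i + 1)
          gcongr
          linarith
      _ = _ := by ring

theorem exists_decay_of_one_le (M : OrliczFunction) (hM : ¬ M.IsDegenerate) {q : ℝ} (hq : 1 ≤ q)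
    (hpq : ENNReal.ofReal q < M.upperIndex) (S : ℕ) (L : ℝ) :
    ∃ A B, S ≤ A ∧ A ≤ B ∧
      L * (M.dyadic B * ((2 : ℝ) ^ q) ^ B) < M.dyadic A * ((2 : ℝ) ^ q) ^ A := by
  by_contra! hcon
  have hpos : ∀ k, 0 < M.dyadic k * ((2 : ℝ) ^ q) ^ k :=
    fun k => mul_pos (M.dyadic_pos hM k) (by positivity)
  obtain ⟨K, hK0, hK⟩ := exists_bound_of_eventual_bound
    (u := fun k => (M.dyadic k * ((2 : ℝ) ^ q) ^ k)⁻¹)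
    (fun k => inv_pos.mpr (hpos k)) S L (fun A B h1 h2 => by
      have := hcon A B h1 h2
      rw [← div_eq_mul_inv, le_div_iff₀ (hpos A), ← div_eq_inv_mul, div_le_iff₀ (hpos B)]
      exact this)
  replace hK : ∀ A B, A ≤ B → M.dyadic A * ((2 : ℝ) ^ q) ^ A ≤
      K * (M.dyadic B * ((2 : ℝ) ^ q) ^ B) := fun A B h => by
    have := hK A B h
    rwa [← div_eq_mul_inv, le_div_iff₀ (hpos A), ← div_eq_inv_mul, div_le_iff₀ (hpos B)] at this
  refine hpq.not_ge (M.upperIndex_le hM (q := q.toNNReal)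
    (c := (K * 2 ^ (q.toNNReal : ℝ) * 2 ^ (q.toNNReal : ℝ))⁻¹)
    (by rwa [Real.one_le_toNNReal]) (by positivity) fun b t hb0 hb1 ht0 ht1 => ?_)
  have hqq : (q.toNNReal : ℝ) = q := Real.coe_toNNReal q (by linarith)
  rw [hqq]
  obtain ⟨i, hi1, hi2⟩ := exists_nat_pow_near_of_lt_one hb0 hb1 (y := (2⁻¹ : ℝ≥0)) (by simp)
    (by norm_num)
  obtain ⟨j, hj1, hj2⟩ := exists_nat_pow_near_of_lt_one ht0 ht1 (y := (2⁻¹ : ℝ≥0)) (by simp)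
    (by norm_num)
  rw [← NNReal.coe_le_coe]
  push_cast
  set r : ℝ := (2 : ℝ) ^ q with hr
  have hr1 : 1 ≤ r := Real.one_le_rpow (by norm_num) (by linarith)
  have htq : (t : ℝ) ^ q ≤ (r ^ j)⁻¹ := by
    have h1 : (t : ℝ) ^ q ≤ ((2⁻¹ : ℝ) ^ j) ^ q :=
      Real.rpow_le_rpow (by positivity) (by exact_mod_cast hj2) (by linarith)
    rwa [← Real.rpow_natCast, ← Real.rpow_mul (by norm_num), mul_comm, Real.rpow_mul (by norm_num),
      Real.inv_rpow (by norm_num), Real.rpow_natCast, inv_pow] at h1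
  have hK0' : (0 : ℝ) < K := hK0
  have h1 : M.dyadic (i + j + 2) ≤ M (b * t) := by
    refine M.mono ?_
    rw [show i + j + 2 = (i + 1) + (j + 1) by ring, pow_add]
    gcongr
  have h2 : M b ≤ M.dyadic i := M.mono hi2
  have h3 := hK i (i + j + 2) (by omega)
  have h4 : M.dyadic i ≤ K * (M.dyadic (i + j + 2) * r ^ (j + 2)) := by
    have e1 : r ^ (i + j + 2) = r ^ (j + 2) * r ^ i := by ring
    rw [e1] at h3
    exact le_of_mul_le_mul_right (by linarith) (show 0 < r ^ i by positivity)
  calc (K * r * r)⁻¹ * (t : ℝ) ^ q * M b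
      ≤ (K * r * r)⁻¹ * (r ^ j)⁻¹ * M.dyadic i := by gcongr
    _ ≤ (K * r * r)⁻¹ * (r ^ j)⁻¹ * (K * (M.dyadic (i + j + 2) * r ^ (j + 2))) := by gcongr
    _ = M.dyadic (i + j + 2) := by field_simp; ring
    _ ≤ _ := h1

/-- Exponents `q < 1` are not seen by `β_M`, but there convexity alone gives the decay: `M` halves
at least at each dyadic step while the power gains only `2 ^ q < 2`. They occur as `p - δ` with `p`
close to `1`. -/
theorem exists_decay (M : OrliczFunction) (hM : ¬ M.IsDegenerate) {q : ℝ}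
    (hpq : q < 1 ∨ ENNReal.ofReal q < M.upperIndex) (S : ℕ) (L : ℝ) :
    ∃ A B, S ≤ A ∧ A ≤ B ∧
      L * (M.dyadic B * ((2 : ℝ) ^ q) ^ B) < M.dyadic A * ((2 : ℝ) ^ q) ^ A := by
  rcases le_or_gt 1 q with hq | hq
  · exact M.exists_decay_of_one_le hM hq (hpq.resolve_left hq.not_gt) S L
  · have hr : (2 : ℝ) ^ q < 2 := by
      simpa using Real.rpow_lt_rpow_of_exponent_lt (x := (2 : ℝ)) (by norm_num) hq
    set r : ℝ := (2 : ℝ) ^ q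
    have hr0 : 0 < r := by positivity
    have hlim : Filter.Tendsto (fun n : ℕ => |L| * (2⁻¹ * r) ^ n) Filter.atTop (𝓝 (|L| * 0)) :=
      (tendsto_pow_atTop_nhds_zero_of_lt_one (by positivity) (by linarith)).const_mul _
    rw [mul_zero] at hlim
    obtain ⟨n, hn⟩ := (hlim.eventually (gt_mem_nhds one_pos)).exists
    refine ⟨S, S + n, le_rfl, Nat.le_add_right _ _, ?_⟩
    have hd := M.dyadic_add_le S n
    have hpos : 0 < M.dyadic S * r ^ S := mul_pos (M.dyadic_pos hM S) (by positivity)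
    have hpos2 : 0 ≤ M.dyadic (S + n) * r ^ (S + n) :=
      mul_nonneg (M.dyadic_nonneg _) (by positivity)
    calc L * (M.dyadic (S + n) * r ^ (S + n)) ≤ |L| * (M.dyadic (S + n) * r ^ (S + n)) := by
          gcongr; exact le_abs_self L
      _ ≤ |L| * ((2⁻¹ ^ n * M.dyadic S) * r ^ (S + n)) := by gcongr
      _ = (|L| * (2⁻¹ * r) ^ n) * (M.dyadic S * r ^ S) := by rw [mul_pow]; ring
      _ < 1 * (M.dyadic S * r ^ S) := by gcongr
      _ = _ := one_mul _

end OrliczFunction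

/-! ### Reproducing `x ^ p` by sums of dilates of `M` -/

/-- The two windows differ by at most `X` terms at each end. Since `h` grows by at most `R` per
step, these terms are controlled by `h A` and `h D`, and each group totals at most half of the
single term `h P`. -/
theorem sum_Ico_shift_bounds {h : ℕ → ℝ} (h0 : ∀ n, 0 ≤ h n) {A P D X k : ℕ} {R : ℝ} (hR : 1 ≤ R)
    (hs : ∀ n, h (n + 1) ≤ R * h n) (hAP : A ≤ P) (hPD : P ≤ D)
    (hA : 2 * (X * R ^ X) * h A ≤ h P) (hD : 2 * (X * R ^ X) * h D ≤ h P) (hk : k ≤ X) :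
    (∑ s ∈ Finset.Ico A (D + 1), h s) / 2 ≤ ∑ s ∈ Finset.Ico A (D + 1), h (s + k) ∧
      ∑ s ∈ Finset.Ico A (D + 1), h (s + k) ≤ 2 * ∑ s ∈ Finset.Ico A (D + 1), h s := by
  have hiter : ∀ n i, h (n + i) ≤ R ^ i * h n := by
    intro n i
    induction i with
    | zero => simp
    | succ i ih =>
      calc h (n + i + 1) ≤ R * h (n + i) := hs _
        _ ≤ R * (R ^ i * h n) := by gcongr
        _ = _ := by ring
  have hend : ∀ a b, (∀ s ∈ Finset.Ico b (b + k), h s ≤ R ^ X * h a) →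
      2 * (X * R ^ X) * h a ≤ h P → ∑ s ∈ Finset.Ico b (b + k), h s ≤ h P / 2 := by
    intro a b hb ha
    have h1 := Finset.sum_le_card_nsmul _ _ _ hb
    rw [Nat.card_Ico, Nat.add_sub_cancel_left, nsmul_eq_mul] at h1
    have h2 : (k : ℝ) * (R ^ X * h a) ≤ X * (R ^ X * h a) := by
      have := h0 a
      gcongr
    linarith
  have hleft : ∑ s ∈ Finset.Ico A (A + k), h s ≤ h P / 2 := by
    refine hend A A (fun s hsm => ?_) hA
    rw [Finset.mem_Ico] at hsm
    obtain ⟨i, rfl⟩ := Nat.exists_eq_add_of_le hsm.1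
    exact (hiter A i).trans (mul_le_mul_of_nonneg_right
      (pow_le_pow_right₀ hR (by omega)) (h0 A))
  have hright : ∑ s ∈ Finset.Ico (D + 1) (D + 1 + k), h s ≤ h P / 2 := by
    refine hend D (D + 1) (fun s hsm => ?_) hD
    rw [Finset.mem_Ico] at hsm
    obtain ⟨i, rfl⟩ := Nat.exists_eq_add_of_le (show D ≤ s by omega)
    exact (hiter D i).trans (mul_le_mul_of_nonneg_right
      (pow_le_pow_right₀ hR (by omega)) (h0 D))
  have hP : h P ≤ ∑ s ∈ Finset.Ico A (D + 1), h s :=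
    Finset.single_le_sum (fun i _ => h0 i) (Finset.mem_Ico.mpr ⟨hAP, by omega⟩)
  have e1 := Finset.sum_Ico_consecutive h (show A ≤ A + k by omega)
    (show A + k ≤ D + 1 + k by omega)
  have e2 := Finset.sum_Ico_consecutive h (show A ≤ D + 1 by omega)
    (show D + 1 ≤ D + 1 + k by omega)
  have p1 : 0 ≤ ∑ s ∈ Finset.Ico A (A + k), h s := Finset.sum_nonneg fun i _ => h0 i
  have p2 : 0 ≤ ∑ s ∈ Finset.Ico (D + 1) (D + 1 + k), h s := Finset.sum_nonneg fun i _ => h0 i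
  have := h0 P
  rw [Finset.sum_Ico_add']
  constructor <;> linarith

namespace OrliczFunction

theorem exists_dyadic_combination (M : OrliczFunction) (hM : ¬ M.IsDegenerate) {p : ℝ}
    (hp : 1 ≤ p) (hα : M.lowerIndex ≤ ENNReal.ofReal p) (hβ : ENNReal.ofReal p ≤ M.upperIndex)
    (X : ℕ) : ∃ (A N : ℕ) (n : ℕ → ℕ), ∀ k ≤ X,
      ((2 ^ p) ^ k)⁻¹ ≤ ∑ s ∈ Finset.Ico A N, n s * M.dyadic (s + k) ∧
      ∑ s ∈ Finset.Ico A N, n s * M.dyadic (s + k) ≤ 17 * ((2 ^ p) ^ k)⁻¹ := by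
  have hp0 : 0 < p := by linarith
  -- Chosen so that `ρ = 2 ^ δ` satisfies `ρ ^ k ≤ 2` for all shifts `k ≤ X`: the weights then
  -- change by at most a factor `2`.
  set δ : ℝ := ((X + 1 : ℕ) : ℝ)⁻¹ with hδ
  have hδ0 : 0 < δ := by positivity
  set r : ℝ := (2 : ℝ) ^ p with hr
  have hr1 : 1 ≤ r := Real.one_le_rpow (by norm_num) hp0.le
  have hr0 : 0 < r := by linarith
  set ρ : ℝ := (2 : ℝ) ^ δ with hρ
  have hρ1 : 1 ≤ ρ := Real.one_le_rpow (by norm_num) hδ0.le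
  have hρ0 : 0 < ρ := by linarith
  have hρX : ∀ k ≤ X, ρ ^ k ≤ 2 := fun k hk => by
    calc ρ ^ k ≤ ρ ^ (X + 1) := pow_le_pow_right₀ hρ1 (by omega)
      _ = 2 := by rw [hρ, ← Real.rpow_natCast, ← Real.rpow_mul (by norm_num), hδ,
          inv_mul_cancel₀ (by positivity), Real.rpow_one]
  set E : ℝ := 2 * (X * (r * ρ) ^ X) with hE
  -- Starting beyond `S` makes the total error of rounding the coefficients to integers at most `(r
  -- ^ X)⁻¹`.
  obtain ⟨S, hS⟩ : ∃ S : ℕ, 2 * (2⁻¹ : ℝ) ^ S ≤ (r ^ X)⁻¹ := by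
    obtain ⟨S, hS⟩ := exists_pow_lt_of_lt_one (show 0 < (r ^ X)⁻¹ / 2 by positivity)
      (show (2⁻¹ : ℝ) < 1 by norm_num)
    exact ⟨S, by linarith⟩
  obtain ⟨A, B, hSA, hAB, hgrow⟩ := M.exists_growth hM (q := p + δ) (by linarith)
    (hα.trans_lt ((ENNReal.ofReal_lt_ofReal_iff (by linarith)).mpr (by linarith))) S E
  obtain ⟨B', D, hBB', hBD, hdec⟩ := M.exists_decay hM (q := p - δ)
    (Or.inr (((ENNReal.ofReal_lt_ofReal_iff hp0).mpr (by linarith)).trans_le hβ)) B E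
  rw [Real.rpow_add (by norm_num), ← hr, ← hρ] at hgrow
  rw [Real.rpow_sub (by norm_num), ← hr, ← hρ] at hdec
  have hd0 : ∀ k, 0 < M.dyadic k := M.dyadic_pos hM
  -- A tent with peak at `B`: it rises like `ρ ^ s` up to `B`, turning growth of exponent `p + δ`
  -- into growth of `h`, and falls like `ρ ^ (-s)` afterwards, turning decay of exponent `p - δ`
  -- into decay of `h`.
  obtain ⟨w, hw⟩ : ∃ w : ℕ → ℝ, ∀ s, w s = min (ρ ^ s) (ρ ^ B * ρ ^ B / ρ ^ s) := ⟨_, fun _ => rfl⟩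
  have hw0 : ∀ s, 0 < w s := fun s => by rw [hw]; positivity
  have hw1 : ∀ s, w (s + 1) ≤ ρ * w s := fun s => by
    rw [hw, hw, mul_min_of_nonneg _ _ hρ0.le]
    refine min_le_min (by rw [pow_succ']) ?_
    calc ρ ^ B * ρ ^ B / ρ ^ (s + 1) ≤ ρ ^ B * ρ ^ B / ρ ^ s := by gcongr; simp
      _ ≤ _ := le_mul_of_one_le_left (by positivity) hρ1
  have hw2 : ∀ s, w s ≤ ρ * w (s + 1) := fun s => by
    rw [hw, hw, mul_min_of_nonneg _ _ hρ0.le]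
    refine min_le_min ?_ (by rw [pow_succ]; field_simp; rfl)
    calc ρ ^ s ≤ ρ ^ (s + 1) := by gcongr; simp
      _ ≤ _ := le_mul_of_one_le_left (by positivity) hρ1
  have hw3 : ∀ s k, w (s + k) ≤ ρ ^ k * w s ∧ w s ≤ ρ ^ k * w (s + k) := by
    intro s k
    induction k with
    | zero => simp
    | succ k ih =>
      rw [pow_succ]
      constructor
      · calc w (s + k + 1) ≤ ρ * w (s + k) := hw1 _
          _ ≤ ρ * (ρ ^ k * w s) := by gcongr; exact ih.1
          _ = _ := by ring
      · calc w s ≤ ρ ^ k * w (s + k) := ih.2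
          _ ≤ ρ ^ k * (ρ * w (s + k + 1)) := by gcongr; exact hw2 _
          _ = _ := by ring_nf
  obtain ⟨h, hh⟩ : ∃ h : ℕ → ℝ, ∀ s, h s = w s * (M.dyadic s * r ^ s) := ⟨_, fun _ => rfl⟩
  have hh0 : ∀ s, 0 < h s := fun s => by
    rw [hh]; exact mul_pos (hw0 s) (mul_pos (hd0 s) (by positivity))
  have hE0 : 0 ≤ E := by positivity
  have hstep : ∀ s, h (s + 1) ≤ r * ρ * h s := fun s => by
    rw [hh, hh]
    calc w (s + 1) * (M.dyadic (s + 1) * r ^ (s + 1))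
        ≤ (ρ * w s) * (M.dyadic s * r ^ (s + 1)) := by
          have := (hw0 s).le
          have := (hd0 (s + 1)).le
          gcongr
          · exact hw1 s
          · exact M.dyadic_antitone (Nat.le_succ s)
      _ = _ := by ring
  have hleft : E * h A ≤ h B := by
    have e : w B = ρ ^ B := by
      rw [hw, mul_div_assoc, div_self (by positivity), mul_one, min_self]
    calc E * h A ≤ E * (ρ ^ A * (M.dyadic A * r ^ A)) := by
          rw [hh]
          have := (hd0 A).le
          gcongr
          rw [hw]
          exact min_le_left _ _
      _ = E * (M.dyadic A * (r * ρ) ^ A) := by rw [mul_pow]; ring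
      _ ≤ M.dyadic B * (r * ρ) ^ B := hgrow.le
      _ = h B := by rw [hh, e, mul_pow]; ring
  have hright : E * h D ≤ h B' := by
    have e : w B' = ρ ^ B * ρ ^ B / ρ ^ B' := by
      rw [hw, min_eq_right]
      rw [div_le_iff₀ (by positivity)]
      have : ρ ^ B ≤ ρ ^ B' := pow_le_pow_right₀ hρ1 hBB'
      gcongr
    calc E * h D ≤ E * (ρ ^ B * ρ ^ B / ρ ^ D * (M.dyadic D * r ^ D)) := by
          rw [hh]
          have := (hd0 D).le
          gcongr
          rw [hw]
          exact min_le_right _ _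
      _ = ρ ^ B * ρ ^ B * (E * (M.dyadic D * (r / ρ) ^ D)) := by rw [div_pow]; ring
      _ ≤ ρ ^ B * ρ ^ B * (M.dyadic B' * (r / ρ) ^ B') := by gcongr
      _ = h B' := by rw [hh, e, div_pow]; ring
  -- Nothing is known between `B` and `B'`; whichever has the larger value of `h` dominates both
  -- ends.
  obtain ⟨P, hAP, hPD, hPA, hPDh⟩ : ∃ P, A ≤ P ∧ P ≤ D ∧ E * h A ≤ h P ∧ E * h D ≤ h P := by
    rcases le_total (h B') (h B) with hle | hle
    · exact ⟨B, hAB, hBB'.trans hBD, hleft, hright.trans hle⟩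
    · exact ⟨B', hAB.trans hBB', hBD, hleft.trans hle, hright⟩
  set T : ℝ := ∑ s ∈ Finset.Ico A (D + 1), h s with hT
  have hT0 : 0 < T := Finset.sum_pos (fun s _ => hh0 s) ⟨P, Finset.mem_Ico.mpr ⟨hAP, by omega⟩⟩
  -- Before rounding, changing the weight costs a factor `2` and shifting the window another `2` on
  -- either side, so the normalization `4 / T` puts the sum between `1` and `16` times `(r ^ k)⁻¹`.
  -- Rounding up adds at most one more, whence `17`.
  refine ⟨A, D + 1, fun s => ⌈4 / T * (w s * r ^ s)⌉₊, fun k hk => ?_⟩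
  obtain ⟨hb1, hb2⟩ := sum_Ico_shift_bounds (fun n => (hh0 n).le)
    (one_le_mul_of_one_le_of_one_le hr1 hρ1) hstep hAP hPD hPA hPDh hk
  rw [← hT] at hb1 hb2
  have hrk : r ^ X ≥ r ^ k := pow_le_pow_right₀ hr1 hk
  have hpt1 : ∀ s, 2⁻¹ * (r ^ k)⁻¹ * h (s + k) ≤ w s * r ^ s * M.dyadic (s + k) := fun s => by
    rw [hh]
    calc 2⁻¹ * (r ^ k)⁻¹ * (w (s + k) * (M.dyadic (s + k) * r ^ (s + k)))
        = 2⁻¹ * w (s + k) * (r ^ s * M.dyadic (s + k)) := by rw [pow_add]; field_simp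
      _ ≤ 2⁻¹ * (2 * w s) * (r ^ s * M.dyadic (s + k)) := by
          have := (hd0 (s + k)).le
          have := (hw0 s).le
          gcongr
          exact (hw3 s k).1.trans (by gcongr; exact hρX k hk)
      _ = _ := by ring
  have hpt2 : ∀ s, w s * r ^ s * M.dyadic (s + k) ≤ 2 * (r ^ k)⁻¹ * h (s + k) := fun s => by
    rw [hh]
    calc w s * r ^ s * M.dyadic (s + k) ≤ 2 * w (s + k) * r ^ s * M.dyadic (s + k) := by
          have := (hd0 (s + k)).le
          have := (hw0 (s + k)).le
          gcongr
          exact (hw3 s k).2.trans (by gcongr; exact hρX k hk)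
      _ = _ := by rw [pow_add]; field_simp
  constructor
  · calc (r ^ k)⁻¹ = 4 / T * (2⁻¹ * (r ^ k)⁻¹ * (T / 2)) := by field_simp; norm_num
      _ ≤ 4 / T * (2⁻¹ * (r ^ k)⁻¹ * ∑ s ∈ Finset.Ico A (D + 1), h (s + k)) := by gcongr
      _ = ∑ s ∈ Finset.Ico A (D + 1), 4 / T * (2⁻¹ * (r ^ k)⁻¹ * h (s + k)) := by
          rw [Finset.mul_sum, Finset.mul_sum]
      _ ≤ _ := by
          refine Finset.sum_le_sum fun s _ => ?_
          calc 4 / T * (2⁻¹ * (r ^ k)⁻¹ * h (s + k))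
              ≤ 4 / T * (w s * r ^ s * M.dyadic (s + k)) :=
                mul_le_mul_of_nonneg_left (hpt1 s) (by positivity)
            _ = 4 / T * (w s * r ^ s) * M.dyadic (s + k) := by ring
            _ ≤ _ := by
              have := (hd0 (s + k)).le
              gcongr
              exact Nat.le_ceil _
  · have hsmall : ∑ s ∈ Finset.Ico A (D + 1), M.dyadic (s + k) ≤ (r ^ k)⁻¹ := by
      calc ∑ s ∈ Finset.Ico A (D + 1), M.dyadic (s + k)
          ≤ ∑ s ∈ Finset.Ico A (D + 1), (2⁻¹ : ℝ) ^ s := by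
            refine Finset.sum_le_sum fun s _ => ?_
            have h1 := M.dyadic_add_le 0 s
            rw [zero_add, M.dyadic_zero, mul_one] at h1
            exact (M.dyadic_antitone (Nat.le_add_right s k)).trans h1
        _ ≤ (2⁻¹ : ℝ) ^ A / (1 - 2⁻¹) := geom_sum_Ico_le_of_lt_one (by norm_num) (by norm_num)
        _ = 2 * (2⁻¹ : ℝ) ^ A := by ring
        _ ≤ 2 * (2⁻¹ : ℝ) ^ S := by
            gcongr 2 * ?_
            exact pow_le_pow_of_le_one (by norm_num) (by norm_num) hSA
        _ ≤ (r ^ X)⁻¹ := hS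
        _ ≤ _ := by gcongr
    calc ∑ s ∈ Finset.Ico A (D + 1), (⌈4 / T * (w s * r ^ s)⌉₊ : ℝ) * M.dyadic (s + k)
        ≤ ∑ s ∈ Finset.Ico A (D + 1),
            (4 / T * (2 * (r ^ k)⁻¹ * h (s + k)) + M.dyadic (s + k)) := by
          refine Finset.sum_le_sum fun s _ => ?_
          have := (hd0 (s + k)).le
          have hws := (hw0 s).le
          calc (⌈4 / T * (w s * r ^ s)⌉₊ : ℝ) * M.dyadic (s + k)
              ≤ (4 / T * (w s * r ^ s) + 1) * M.dyadic (s + k) := by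
                gcongr
                exact (Nat.ceil_lt_add_one (by positivity)).le
            _ = 4 / T * (w s * r ^ s * M.dyadic (s + k)) + M.dyadic (s + k) := by ring
            _ ≤ _ := by linarith [mul_le_mul_of_nonneg_left (hpt2 s) (show 0 ≤ 4 / T by positivity)]
      _ = 4 / T * (2 * (r ^ k)⁻¹ * ∑ s ∈ Finset.Ico A (D + 1), h (s + k)) +
            ∑ s ∈ Finset.Ico A (D + 1), M.dyadic (s + k) := by
          rw [Finset.sum_add_distrib, Finset.mul_sum, Finset.mul_sum]
      _ ≤ 4 / T * (2 * (r ^ k)⁻¹ * (2 * T)) + (r ^ k)⁻¹ := by gcongr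
      _ = 17 * (r ^ k)⁻¹ := by field_simp; norm_num

theorem exists_list_sum_eq (M : OrliczFunction) (I : Finset ℕ) (n : ℕ → ℕ) :
    ∃ l : List ℝ≥0, ∀ x : ℝ≥0,
      (l.map fun v => M (x * v)).sum = ∑ s ∈ I, n s * M (x * 2⁻¹ ^ s) := by
  induction I using Finset.induction_on with
  | empty => exact ⟨[], by simp⟩
  | insert s I hs ih =>
    obtain ⟨l, hl⟩ := ih
    exact ⟨List.replicate (n s) (2⁻¹ ^ s) ++ l, fun x => by simp [hl, Finset.sum_insert hs]⟩

theorem list_sum_mono (M : OrliczFunction) (l : List ℝ≥0) :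
    Monotone fun x : ℝ≥0 => (l.map fun v => M (x * v)).sum := fun _ _ hxy =>
  List.sum_le_sum fun v _ => M.mono (mul_le_mul_left hxy v)

/-- Monotonicity extends the comparison from dyadic points to `[0, 1]`, at the cost of a factor `2 ^
p`. The constant does not depend on `ε`, which is what allows infinitely many blocks to be used
together. -/
theorem exists_power_block (M : OrliczFunction) (hM : ¬ M.IsDegenerate) {p : ℝ}
    (hp : 1 ≤ p) (hα : M.lowerIndex ≤ ENNReal.ofReal p) (hβ : ENNReal.ofReal p ≤ M.upperIndex)
    {ε : ℝ≥0} (hε : 0 < ε) : ∃ l : List ℝ≥0, 1 ≤ (l.map fun v => M (1 * v)).sum ∧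
      ∀ x ≤ 1, (l.map fun v => M (x * v)).sum ≤ (17 * 2 ^ p) * x ^ p + ε ∧
        x ^ p ≤ (17 * 2 ^ p) * (l.map fun v => M (x * v)).sum + ε := by
  have hp0 : 0 < p := by linarith
  set r : ℝ≥0 := 2 ^ p with hr
  have hr1 : 1 < r := NNReal.one_lt_rpow (by norm_num) hp0
  have hr0 : 0 < r := zero_lt_one.trans hr1
  obtain ⟨X, hX⟩ := exists_pow_lt_of_lt_one (show 0 < ε / 17 by positivity)
    (inv_lt_one_of_one_lt₀ hr1)
  have hX17 : 17 * (r ^ X)⁻¹ ≤ ε := by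
    rw [inv_pow, lt_div_iff₀ (by norm_num)] at hX
    rw [mul_comm]; exact hX.le
  have hX1 : (r ^ X)⁻¹ ≤ ε := (le_mul_of_one_le_left zero_le (by norm_num)).trans hX17
  obtain ⟨A, N, n, hn⟩ := M.exists_dyadic_combination hM hp hα hβ X
  obtain ⟨l, hl⟩ := M.exists_list_sum_eq (Finset.Ico A N) n
  have hmono := M.list_sum_mono l
  set F : ℝ≥0 → ℝ≥0 := fun x => (l.map fun v => M (x * v)).sum with hF
  have hFk : ∀ k ≤ X, (r ^ k)⁻¹ ≤ F (2⁻¹ ^ k) ∧ F (2⁻¹ ^ k) ≤ 17 * (r ^ k)⁻¹ := by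
    intro k hk
    have e : (F (2⁻¹ ^ k) : ℝ) = ∑ s ∈ Finset.Ico A N, n s * M.dyadic (s + k) := by
      rw [show F (2⁻¹ ^ k) = _ from hl _]
      push_cast
      exact Finset.sum_congr rfl fun s _ => by rw [dyadic, ← pow_add, add_comm k s]
    rw [← NNReal.coe_le_coe, ← NNReal.coe_le_coe]
    push_cast
    rw [e]
    exact hn k hk
  have hpow : ∀ k : ℕ, ((2⁻¹ : ℝ≥0) ^ k) ^ p = (r ^ k)⁻¹ := fun k => by
    rw [← NNReal.rpow_natCast, ← NNReal.rpow_mul, mul_comm, NNReal.rpow_mul, NNReal.inv_rpow,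
      NNReal.rpow_natCast, inv_pow]
  have hone : 1 ≤ F 1 := by simpa using (hFk 0 X.zero_le).1
  refine ⟨l, hone, fun x hx => ?_⟩
  change F x ≤ _ ∧ _ ≤ _ * F x + _
  -- Below the last controlled dyadic point both `F x` and `x ^ p` are at most `ε`, by the choice of
  -- `X`.
  rcases le_or_gt x (2⁻¹ ^ X) with hxX | hxX
  · constructor
    · exact ((hmono hxX).trans ((hFk X le_rfl).2.trans hX17)).trans le_add_self
    · refine le_trans ?_ (le_add_self (a := ε))
      refine (NNReal.rpow_le_rpow hxX hp0.le).trans ?_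
      rw [hpow]
      exact hX1
  · obtain ⟨k, hk1, hk2⟩ := exists_nat_pow_near_of_lt_one (zero_le.trans_lt hxX) hx
      (y := (2⁻¹ : ℝ≥0)) (by simp) (by norm_num)
    have hkX : k + 1 ≤ X := by
      by_contra! h
      exact (hxX.trans_le hk2).not_ge (pow_le_pow_of_le_one zero_le (by norm_num) (by omega))
    have e : (r ^ k)⁻¹ = r * (r ^ (k + 1))⁻¹ := by rw [pow_succ]; field_simp
    constructor
    · refine le_trans ?_ le_self_add
      calc F x ≤ F (2⁻¹ ^ k) := hmono hk2
        _ ≤ 17 * (r ^ k)⁻¹ := (hFk k (by omega)).2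
        _ = 17 * r * (2⁻¹ ^ (k + 1)) ^ p := by rw [hpow, e]; ring
        _ ≤ 17 * r * x ^ p := by gcongr
    · refine le_trans ?_ le_self_add
      calc x ^ p ≤ (2⁻¹ ^ k) ^ p := by gcongr
        _ = r * (r ^ (k + 1))⁻¹ := by rw [hpow, e]
        _ ≤ r * F (2⁻¹ ^ (k + 1)) := by gcongr; exact (hFk (k + 1) hkX).1
        _ ≤ 17 * r * F x := by
          have h1 : F (2⁻¹ ^ (k + 1)) ≤ F x := hmono hk1.le
          have h2 : r ≤ 17 * r := le_mul_of_one_le_left zero_le (by norm_num)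
          gcongr

theorem exists_sup_block (M : OrliczFunction) (hM : ¬ M.IsDegenerate)
    (hβ : M.upperIndex = ∞) {ε : ℝ≥0} (hε : 0 < ε) :
    ∃ l : List ℝ≥0, 1 ≤ (l.map fun v => M (1 * v)).sum ∧
      (l.map fun v => M (2⁻¹ * v)).sum ≤ ε := by
  -- If no such ratio existed, `M.dyadic k * (2 ^ n) ^ k` would be nondecreasing once `2 ^ n ≥ 2 /
  -- ε`, contradicting `exists_decay` with `L = 1`.
  obtain ⟨k, hk⟩ : ∃ k, M.dyadic (k + 1) < ε / 2 * M.dyadic k := by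
    by_contra! hcon
    obtain ⟨n, hn⟩ := pow_unbounded_of_one_lt ((ε : ℝ) / 2)⁻¹ (show (1 : ℝ) < 2 by norm_num)
    have hε' : (0 : ℝ) < ε / 2 := by positivity
    obtain ⟨A, B, -, hAB, h⟩ := M.exists_decay hM (q := n)
      (Or.inr (by rw [hβ]; exact ENNReal.ofReal_lt_top)) 0 1
    rw [one_mul, Real.rpow_natCast] at h
    refine h.not_ge ?_
    refine monotone_nat_of_le_succ (f := fun k => M.dyadic k * ((2 : ℝ) ^ n) ^ k) (fun k => ?_) hAB
    have h1 : 1 ≤ (ε : ℝ) / 2 * 2 ^ n := by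
      rw [← inv_le_iff_one_le_mul₀' hε']
      exact hn.le
    have h0 := M.dyadic_nonneg k
    calc M.dyadic k * ((2 : ℝ) ^ n) ^ k ≤ ((ε : ℝ) / 2 * 2 ^ n) * (M.dyadic k * ((2 : ℝ) ^ n) ^ k) :=
          le_mul_of_one_le_left (by positivity) h1
      _ = ((ε : ℝ) / 2 * M.dyadic k) * ((2 : ℝ) ^ n) ^ (k + 1) := by ring
      _ ≤ _ := by gcongr; exact hcon k
  set m := M (2⁻¹ ^ k) with hm
  have hm0 : 0 < m := M.map_pos hM (by positivity)
  have hm1 : m ≤ 1 := M.map_one' ▸ M.mono (pow_le_one₀ zero_le (by norm_num))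
  have hk' : M (2⁻¹ ^ (k + 1)) ≤ ε / 2 * m := by
    rw [← NNReal.coe_le_coe]; push_cast; exact hk.le
  refine ⟨List.replicate ⌈m⁻¹⌉₊ (2⁻¹ ^ k), ?_, ?_⟩
  · rw [List.map_replicate, List.sum_replicate, one_mul, nsmul_eq_mul]
    calc (1 : ℝ≥0) = m⁻¹ * m := (inv_mul_cancel₀ hm0.ne').symm
      _ ≤ _ := by gcongr; exact Nat.le_ceil _
  · rw [List.map_replicate, List.sum_replicate, ← pow_succ', nsmul_eq_mul]
    have h1 : (⌈m⁻¹⌉₊ : ℝ≥0) ≤ 2 * m⁻¹ := by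
      refine (Nat.ceil_lt_add_one zero_le).le.trans ?_
      rw [two_mul]
      gcongr
      exact (one_le_inv₀ hm0).mpr hm1
    calc (⌈m⁻¹⌉₊ : ℝ≥0) * M (2⁻¹ ^ (k + 1)) ≤ (2 * m⁻¹) * (ε / 2 * m) := by gcongr
      _ = ε := by field_simp

end OrliczFunction

/-! ### Modulars in `ℓ_M` and the construction of blocks -/

theorem ENNReal.tsum_getD_eq_sum (l : List ℝ≥0) (φ : ℝ≥0 → ℝ≥0) (h0 : φ 0 = 0) :
    ∑' j, (φ (l.getD j 0) : ℝ≥0∞) = ((l.map φ).sum : ℝ≥0) := by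
  induction l with
  | nil => simp only [List.getD_nil, h0, ENNReal.coe_zero, tsum_zero, List.map_nil, List.sum_nil]
  | cons a l ih =>
    rw [tsum_eq_zero_add' ENNReal.summable]
    simp only [List.getD_cons_zero, List.getD_cons_succ, List.map_cons, List.sum_cons]
    rw [ih, ENNReal.coe_add]

namespace OrliczSpace

variable {𝕜 : Type*} [RCLike 𝕜] {M : OrliczFunction}

/-- The modular of `x • f` for a nonnegative scalar `x`. -/
noncomputable def modularAt (f : OrliczSpace 𝕜 M) (x : ℝ≥0) : ℝ≥0∞ :=
  ∑' j, (M (x * ‖f.coord j‖₊) : ℝ≥0∞)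

theorem modularAt_mono (f : OrliczSpace 𝕜 M) : Monotone f.modularAt := fun _ _ h =>
  ENNReal.tsum_le_tsum fun _ => ENNReal.coe_le_coe.mpr (M.mono (mul_le_mul_left h _))

theorem modularAt_mul_le (f : OrliczSpace 𝕜 M) {a : ℝ≥0} (ha : a ≤ 1) (x : ℝ≥0) :
    f.modularAt (a * x) ≤ a * f.modularAt x := by
  rw [modularAt, modularAt, ← ENNReal.tsum_mul_left]
  refine ENNReal.tsum_le_tsum fun j => ?_
  rw [mul_assoc, ← ENNReal.coe_mul, ENNReal.coe_le_coe]
  exact M.le_smul ha _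

theorem le_one_of_modularAt_le_one (f : OrliczSpace 𝕜 M) (h1 : 1 ≤ f.modularAt 1) {x : ℝ≥0}
    (hx : f.modularAt x ≤ 1) : x ≤ 1 := by
  by_contra! h
  have hx0 : x ≠ 0 := (zero_lt_one.trans h).ne'
  have h2 := f.modularAt_mul_le (inv_le_one_of_one_le₀ h.le) x
  rw [inv_mul_cancel₀ hx0] at h2
  have h3 : (1 : ℝ≥0∞) ≤ ((x⁻¹ : ℝ≥0) : ℝ≥0∞) * 1 := (h1.trans h2).trans (by gcongr)
  rw [mul_one, ENNReal.one_le_coe_iff] at h3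
  exact h3.not_gt (inv_lt_one_of_one_lt₀ h)

theorem modular_div_eq (f : OrliczSpace 𝕜 M) (t : ℝ≥0) :
    M.modular (fun j => f.coord j / ((t : ℝ) : 𝕜)) = f.modularAt t⁻¹ := by
  simp only [OrliczFunction.modular, OrliczFunction.nnnorm_div_coe, modularAt]
  simp only [div_eq_inv_mul]

theorem norm_le_of_modularAt_le_one (f : OrliczSpace 𝕜 M) {t : ℝ≥0} (ht : 0 < t)
    (h : f.modularAt t⁻¹ ≤ 1) : ‖f‖ ≤ t :=
  ENNReal.toReal_le_coe_of_le_coe (M.luxemburg_le ht (by rwa [modular_div_eq]))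

theorem modularAt_le_one_of_norm_lt (f : OrliczSpace 𝕜 M) {t : ℝ≥0} (h : ‖f‖ < t) :
    f.modularAt t⁻¹ ≤ 1 := by
  have h' : M.luxemburg f.coord < t := by
    rwa [norm_def, ← ENNReal.coe_toReal t,
      ENNReal.toReal_lt_toReal f.luxemburg_ne_top ENNReal.coe_ne_top] at h
  obtain ⟨s, hs, hs0, hm⟩ := M.exists_of_luxemburg_lt h'
  rw [modular_div_eq] at hm
  exact (f.modularAt_mono (inv_anti₀ hs0 (ENNReal.coe_lt_coe.mp hs).le)).trans hm

theorem coord_add (f g : OrliczSpace 𝕜 M) : (f + g).coord = f.coord + g.coord := rfl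

theorem coord_smul (c : 𝕜) (f : OrliczSpace 𝕜 M) : (c • f).coord = c • f.coord := rfl

theorem coord_sum {ι : Type*} (s : Finset ι) (f : ι → OrliczSpace 𝕜 M) (j : ℕ) :
    (∑ i ∈ s, f i).coord j = ∑ i ∈ s, (f i).coord j := by
  induction s using Finset.cons_induction with
  | empty => rfl
  | cons a s ha ih => rw [Finset.sum_cons, Finset.sum_cons, coord_add, Pi.add_apply, ih]

theorem DisjointlySupported.modularAt_sum {f : ℕ → OrliczSpace 𝕜 M} (hf : DisjointlySupported f)
    (a : ℕ →₀ 𝕜) (x : ℝ≥0) :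
    (a.sum fun n c => c • f n).modularAt x =
      ∑ n ∈ a.support, (f n).modularAt (x * ‖a n‖₊) := by
  unfold modularAt
  rw [← Summable.tsum_finsetSum fun _ _ => ENNReal.summable]
  refine tsum_congr fun j => ?_
  rw [Finsupp.sum, coord_sum]
  simp only [coord_smul, Pi.smul_apply, smul_eq_mul]
  by_cases h : ∃ n ∈ a.support, (f n).coord j ≠ 0
  · obtain ⟨n, hn, hnj⟩ := h
    have hz : ∀ m ∈ a.support, m ≠ n → (f m).coord j = 0 := fun m _ hmn => by
      by_contra hmj
      exact Set.disjoint_left.mp (hf hmn) hmj hnj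
    rw [Finset.sum_eq_single_of_mem n hn fun m hm hmn => by rw [hz m hm hmn, mul_zero],
      Finset.sum_eq_single_of_mem n hn fun m hm hmn => by simp [hz m hm hmn, M.map_zero'],
      nnnorm_mul, mul_assoc]
  · push Not at h
    rw [Finset.sum_eq_zero fun m hm => by rw [h m hm, mul_zero],
      Finset.sum_eq_zero fun m hm => by simp [h m hm, M.map_zero']]
    simp [M.map_zero']

theorem IsBlockSequence.disjointlySupported {f : ℕ → OrliczSpace 𝕜 M} (hf : IsBlockSequence f) :
    DisjointlySupported f := by
  obtain ⟨k, -, hk, hf⟩ := hf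
  intro m n hmn
  exact (hk.monotone.pairwise_disjoint_on_Ico_succ hmn).mono (hf m) (hf n)

theorem exists_blockSequence (𝕜 : Type*) [RCLike 𝕜] (M : OrliczFunction) (l : ℕ → List ℝ≥0)
    (hl : ∀ n, l n ≠ []) : ∃ f : ℕ → OrliczSpace 𝕜 M, IsBlockSequence f ∧
      ∀ n x, (f n).modularAt x = (((l n).map fun v => M (x * v)).sum : ℝ≥0) := by
  set k : ℕ → ℕ := fun n => ∑ i ∈ Finset.range n, (l i).length with hk
  have hk1 : ∀ n, k (n + 1) = k n + (l n).length := fun n => Finset.sum_range_succ _ _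
  -- The list `l n` is placed at positions `k n, …, k (n + 1) - 1`; padding zeros on the left and
  -- the default `0` on the right contribute nothing since `M 0 = 0`.
  set g : ℕ → ℕ → ℝ≥0 := fun n j => (List.replicate (k n) 0 ++ l n).getD j 0 with hg
  have hmod : ∀ n (x : ℝ≥0), ∑' j, (M (x * g n j) : ℝ≥0∞) =
      (((l n).map fun v => M (x * v)).sum : ℝ≥0) := fun n x => by
    rw [hg, ENNReal.tsum_getD_eq_sum _ (fun v => M (x * v)) (by simp [M.map_zero'])]
    simp [M.map_zero']
  have hnn : ∀ n j, ‖((g n j : ℝ) : 𝕜)‖₊ = g n j := fun n j => by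
    ext; simp
  have hfin : ∀ n, (fun j => ((g n j : ℝ) : 𝕜)) ∈ M.finiteNorm 𝕜 := fun n => by
    set m : ℝ≥0 := ((l n).map fun v => M (1 * v)).sum + 1 with hm
    have hm0 : 0 < m := by positivity
    have hm1 : 1 ≤ m := le_add_self
    refine lt_of_le_of_lt (M.luxemburg_le hm0 ?_) (ENNReal.coe_lt_top (r := m))
    calc M.modular (fun j => ((g n j : ℝ) : 𝕜) / ((m : ℝ) : 𝕜))
        ≤ ∑' j, ((m⁻¹ : ℝ≥0) : ℝ≥0∞) * (M (1 * g n j) : ℝ≥0∞) := by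
          refine ENNReal.tsum_le_tsum fun j => ?_
          rw [OrliczFunction.nnnorm_div_coe, hnn, div_eq_inv_mul, ← ENNReal.coe_mul,
            ENNReal.coe_le_coe, one_mul]
          exact M.le_smul (inv_le_one_of_one_le₀ hm1) _
      _ ≤ 1 := by
          rw [ENNReal.tsum_mul_left, hmod, ← ENNReal.coe_mul, ENNReal.coe_le_one_iff,
            inv_mul_le_iff₀ hm0, mul_one]
          exact le_self_add
  refine ⟨fun n => ⟨_, hfin n⟩, ⟨k, by simp [hk], strictMono_nat_of_lt_succ fun n => ?_, ?_⟩, ?_⟩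
  · rw [hk1]
    exact Nat.lt_add_of_pos_right (List.length_pos_iff.mpr (hl n))
  · intro n j hj
    have hj' : g n j ≠ 0 := fun h => hj (by
      change ((g n j : ℝ) : 𝕜) = 0
      simp [h])
    rw [Set.mem_Ico, hk1]
    by_contra hcon
    refine hj' ?_
    rcases lt_or_ge j (k n) with h | h
    · rw [hg]
      simp only [List.getD_append _ _ _ _ (show j < (List.replicate (k n) (0 : ℝ≥0)).length by
        simpa using h)]
      exact List.getD_replicate _ h
    · exact List.getD_eq_default _ _ (by simp; omega)
  · intro n x
    rw [← hmod n x]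
    exact tsum_congr fun j => congrArg (fun y : ℝ≥0 => (M (x * y) : ℝ≥0∞)) (hnn n j)

end OrliczSpace

/-! ### Sufficiency: blocks equivalent to the unit vectors of `ℓ_p` -/

theorem sum_inv_two_pow_le_one (s : Finset ℕ) : ∑ n ∈ s, (2⁻¹ : ℝ≥0) ^ (n + 1) ≤ 1 := by
  have h : HasSum (fun n : ℕ => (2⁻¹ : ℝ) ^ (n + 1)) 1 := by
    have := (hasSum_geometric_of_lt_one (r := (2⁻¹ : ℝ)) (by norm_num) (by norm_num)).mul_left 2⁻¹
    rw [show 2⁻¹ * (1 - 2⁻¹)⁻¹ = (1 : ℝ) by norm_num] at this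
    simpa only [pow_succ'] using this
  rw [← NNReal.coe_le_coe]
  push_cast
  exact sum_le_hasSum s (fun i _ => by positivity) h

section lpUnitVector

variable {𝕜 : Type*} [RCLike 𝕜] {p : ℝ≥0∞}

theorem lpUnitVector_sum_eq (a : ℕ →₀ 𝕜) :
    (a.sum fun n c => c • lpUnitVector 𝕜 p n) = ∑ n ∈ a.support, lp.single p n (a n) :=
  Finset.sum_congr rfl fun n _ => by
    change a n • lp.single (E := fun _ : ℕ => 𝕜) p n 1 = _
    rw [← lp.single_smul, smul_eq_mul, mul_one]

theorem lpUnitVector_sum_apply (a : ℕ →₀ 𝕜) (j : ℕ) :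
    (a.sum fun n c => c • lpUnitVector 𝕜 p n) j = a j := by
  rw [lpUnitVector_sum_eq]
  rw [lp.coeFn_sum, Finset.sum_apply]
  simp only [lp.single_apply, Finset.sum_pi_single]
  by_cases h : a j = 0 <;> simp [h]

variable [Fact (1 ≤ p)]

theorem norm_lpUnitVector_sum_rpow (hp : p ≠ ∞) (a : ℕ →₀ 𝕜) :
    ‖a.sum fun n c => c • lpUnitVector 𝕜 p n‖ ^ p.toReal = ∑ n ∈ a.support, ‖a n‖ ^ p.toReal := by
  rw [lpUnitVector_sum_eq]
  exact lp.norm_sum_single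
    (ENNReal.toReal_pos (zero_lt_one.trans_le (Fact.out : 1 ≤ p)).ne' hp) (fun n => a n) a.support

theorem norm_lpUnitVector (n : ℕ) : ‖lpUnitVector 𝕜 p n‖ = 1 := by
  rw [lpUnitVector, lp.norm_single (zero_lt_one.trans_le Fact.out), norm_one]

theorem norm_le_norm_lpUnitVector_sum (a : ℕ →₀ 𝕜) (n : ℕ) :
    ‖a n‖ ≤ ‖a.sum fun n c => c • lpUnitVector 𝕜 p n‖ := by
  have h := lp.norm_apply_le_norm (zero_lt_one.trans_le (Fact.out : 1 ≤ p)).ne'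
    (a.sum fun n c => c • lpUnitVector 𝕜 p n) n
  rwa [lpUnitVector_sum_apply] at h

end lpUnitVector

theorem norm_lpUnitVector_top_sum_le {𝕜 : Type*} [RCLike 𝕜] (a : ℕ →₀ 𝕜) {R : ℝ} (hR : 0 ≤ R)
    (h : ∀ n, ‖a n‖ ≤ R) : ‖a.sum fun n c => c • lpUnitVector 𝕜 ∞ n‖ ≤ R :=
  lp.norm_le_of_forall_le hR fun n => by rw [lpUnitVector_sum_apply]; exact h n

/-- Strict bounds suffice by letting `R` decrease to the norm; this avoids asking whether the
infimum in the Luxemburg norm is attained. -/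
theorem equivalentSequences_of_bounds {𝕜 X Y : Type*} [RCLike 𝕜] [NormedAddCommGroup X]
    [NormedSpace 𝕜 X] [NormedAddCommGroup Y] [NormedSpace 𝕜 Y] {x : ℕ → X} {y : ℕ → Y} (C : ℝ)
    (h1 : ∀ (a : ℕ →₀ 𝕜) (R : ℝ≥0), ‖a.sum fun j c => c • y j‖ < R →
      ‖a.sum fun j c => c • x j‖ ≤ C * R)
    (h2 : ∀ (a : ℕ →₀ 𝕜) (R : ℝ≥0), ‖a.sum fun j c => c • x j‖ < R →
      ‖a.sum fun j c => c • y j‖ ≤ C * R) : EquivalentSequences 𝕜 x y := by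
  have key : ∀ u v : ℝ, 0 ≤ u → (∀ R : ℝ≥0, u < R → v ≤ C * R) → v ≤ C * u := by
    intro u v hu h
    have hlim : Filter.Tendsto (fun R : ℝ => C * R) (𝓝[>] u) (𝓝 (C * u)) :=
      ((continuous_const.mul continuous_id).tendsto u).mono_left nhdsWithin_le_nhds
    refine ge_of_tendsto hlim ?_
    filter_upwards [self_mem_nhdsWithin] with R hR
    exact h ⟨R, hu.trans (le_of_lt hR)⟩ hR
  exact ⟨C, fun a => ⟨key _ _ (norm_nonneg _) (h1 a), key _ _ (norm_nonneg _) (h2 a)⟩⟩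

namespace OrliczSpace

variable {𝕜 : Type*} [RCLike 𝕜] {M : OrliczFunction}

/-- Summing the pointwise comparisons, the errors total at most `1`, so a modular bounded by `1` on
one side is bounded by `C + 1` on the other. Convexity of the modular, or homogeneity of the power,
converts this into a factor `C + 1` in norm. -/
theorem DisjointlySupported.equivalent_lp {p : ℝ≥0∞} [hp1 : Fact (1 ≤ p)] (hp : p ≠ ∞)
    {f : ℕ → OrliczSpace 𝕜 M} (hf : DisjointlySupported f) {C : ℝ≥0} {F : ℕ → ℝ≥0 → ℝ≥0}
    (hF : ∀ n x, (f n).modularAt x = F n x) (hone : ∀ n, 1 ≤ F n 1)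
    (hub : ∀ n, ∀ x ≤ 1, F n x ≤ C * x ^ p.toReal + 2⁻¹ ^ (n + 1))
    (hlb : ∀ n, ∀ x ≤ 1, x ^ p.toReal ≤ C * F n x + 2⁻¹ ^ (n + 1)) :
    EquivalentSequences 𝕜 f (lpUnitVector 𝕜 p) := by
  have hpr : 1 ≤ p.toReal := by
    rw [← ENNReal.toReal_one]
    exact ENNReal.toReal_mono hp hp1.out
  have hpr0 : 0 < p.toReal := by linarith
  have hC1 : 1 ≤ C + 1 := le_add_self
  refine equivalentSequences_of_bounds ((C + 1 : ℝ≥0) : ℝ) (fun a R h => ?_) (fun a R h => ?_)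
  · have hR : 0 < R := NNReal.coe_pos.mp ((norm_nonneg _).trans_lt h)
    have hsum : ∑ n ∈ a.support, (R⁻¹ * ‖a n‖₊) ^ p.toReal ≤ 1 := by
      have h1 := Real.rpow_le_rpow (norm_nonneg _) h.le hpr0.le
      rw [norm_lpUnitVector_sum_rpow hp] at h1
      simp only [NNReal.mul_rpow, ← Finset.mul_sum, NNReal.inv_rpow]
      rw [inv_mul_le_iff₀ (NNReal.rpow_pos hR), mul_one, ← NNReal.coe_le_coe]
      push_cast
      exact h1
    rw [← NNReal.coe_mul]
    refine norm_le_of_modularAt_le_one _ (by positivity) ?_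
    rw [mul_inv]
    refine (modularAt_mul_le _ (inv_le_one_of_one_le₀ hC1) _).trans ?_
    rw [hf.modularAt_sum]
    simp only [hF]
    rw [← ENNReal.ofNNReal_finsetSum, ← ENNReal.coe_mul, ENNReal.coe_le_one_iff,
      inv_mul_le_iff₀ (by positivity), mul_one]
    calc ∑ n ∈ a.support, F n (R⁻¹ * ‖a n‖₊)
        ≤ ∑ n ∈ a.support, (C * (R⁻¹ * ‖a n‖₊) ^ p.toReal + 2⁻¹ ^ (n + 1)) := by
          refine Finset.sum_le_sum fun n hn => hub n _ ?_
          by_contra! hlt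
          exact (NNReal.one_lt_rpow hlt hpr0).not_ge ((Finset.single_le_sum
            (f := fun n => (R⁻¹ * ‖a n‖₊) ^ p.toReal) (fun _ _ => zero_le) hn).trans hsum)
      _ = C * ∑ n ∈ a.support, (R⁻¹ * ‖a n‖₊) ^ p.toReal + ∑ n ∈ a.support, 2⁻¹ ^ (n + 1) := by
          rw [Finset.sum_add_distrib, Finset.mul_sum]
      _ ≤ C * 1 + 1 := by gcongr; exact sum_inv_two_pow_le_one _
      _ = C + 1 := by rw [mul_one]
  · have hR : 0 < R := NNReal.coe_pos.mp ((norm_nonneg _).trans_lt h)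
    have hm := modularAt_le_one_of_norm_lt _ h
    rw [hf.modularAt_sum] at hm
    -- The comparison is available only on `[0, 1]`; the normalization `hone` forces the scaled
    -- coefficients into that interval.
    have hle : ∀ n ∈ a.support, R⁻¹ * ‖a n‖₊ ≤ 1 := fun n hn =>
      (f n).le_one_of_modularAt_le_one (by rw [hF]; exact_mod_cast hone n)
        ((Finset.single_le_sum (f := fun n => (f n).modularAt (R⁻¹ * ‖a n‖₊))
          (fun _ _ => zero_le) hn).trans hm)
    simp only [hF] at hm
    rw [← ENNReal.ofNNReal_finsetSum, ENNReal.coe_le_one_iff] at hm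
    have hsum : ∑ n ∈ a.support, (R⁻¹ * ‖a n‖₊) ^ p.toReal ≤ C + 1 := by
      calc ∑ n ∈ a.support, (R⁻¹ * ‖a n‖₊) ^ p.toReal
          ≤ ∑ n ∈ a.support, (C * F n (R⁻¹ * ‖a n‖₊) + 2⁻¹ ^ (n + 1)) :=
            Finset.sum_le_sum fun n hn => hlb n _ (hle n hn)
        _ = C * ∑ n ∈ a.support, F n (R⁻¹ * ‖a n‖₊) + ∑ n ∈ a.support, 2⁻¹ ^ (n + 1) := by
            rw [Finset.sum_add_distrib, Finset.mul_sum]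
        _ ≤ C * 1 + 1 := by gcongr; exact sum_inv_two_pow_le_one _
        _ = C + 1 := by rw [mul_one]
    simp only [NNReal.mul_rpow, ← Finset.mul_sum, NNReal.inv_rpow] at hsum
    rw [inv_mul_le_iff₀ (NNReal.rpow_pos hR)] at hsum
    rw [← Real.rpow_le_rpow_iff (norm_nonneg _) (by positivity) hpr0,
      norm_lpUnitVector_sum_rpow hp]
    have h1 : ∑ n ∈ a.support, ‖a n‖₊ ^ p.toReal ≤ ((C + 1) * R) ^ p.toReal := by
      refine hsum.trans ?_
      rw [NNReal.mul_rpow, mul_comm]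
      gcongr
      simpa using NNReal.rpow_le_rpow_of_exponent_le hC1 hpr
    have h2 := NNReal.coe_le_coe.mpr h1
    push_cast at h2 ⊢
    exact h2

theorem DisjointlySupported.equivalent_lp_top {f : ℕ → OrliczSpace 𝕜 M}
    (hf : DisjointlySupported f) (hone : ∀ n, 1 ≤ (f n).modularAt 1)
    (hhalf : ∀ n, (f n).modularAt 2⁻¹ ≤ ((2⁻¹ ^ (n + 1) : ℝ≥0) : ℝ≥0∞)) :
    EquivalentSequences 𝕜 f (lpUnitVector 𝕜 ∞) := by
  refine equivalentSequences_of_bounds ((2 : ℝ≥0) : ℝ) (fun a R h => ?_) (fun a R h => ?_)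
  · have hR : 0 < R := NNReal.coe_pos.mp ((norm_nonneg _).trans_lt h)
    rw [← NNReal.coe_mul]
    refine norm_le_of_modularAt_le_one _ (by positivity) ?_
    rw [hf.modularAt_sum]
    refine (Finset.sum_le_sum fun n _ => ((f n).modularAt_mono ?_).trans (hhalf n)).trans ?_
    · have h1 : ‖a n‖₊ ≤ R :=
        NNReal.coe_le_coe.mp ((norm_le_norm_lpUnitVector_sum (p := ∞) a n).trans h.le)
      rw [mul_inv, mul_assoc]
      refine mul_le_of_le_one_right zero_le ?_
      rwa [inv_mul_le_iff₀ hR, mul_one]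
    · rw [← ENNReal.ofNNReal_finsetSum, ENNReal.coe_le_one_iff]
      exact sum_inv_two_pow_le_one _
  · have hR : 0 < R := NNReal.coe_pos.mp ((norm_nonneg _).trans_lt h)
    have hm := modularAt_le_one_of_norm_lt _ h
    rw [hf.modularAt_sum] at hm
    refine norm_lpUnitVector_top_sum_le a (by positivity) fun n => ?_
    refine le_trans ?_ (le_mul_of_one_le_left R.coe_nonneg (by norm_num))
    by_cases hn : n ∈ a.support
    · have h1 := (f n).le_one_of_modularAt_le_one (hone n)
        ((Finset.single_le_sum (f := fun n => (f n).modularAt (R⁻¹ * ‖a n‖₊))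
          (fun _ _ => zero_le) hn).trans hm)
      rw [inv_mul_le_iff₀ hR, mul_one] at h1
      exact_mod_cast h1
    · rw [Finsupp.notMem_support_iff.mp hn, norm_zero]
      exact R.coe_nonneg

theorem exists_blockSequence_equivalent_lp (𝕜 : Type*) [RCLike 𝕜] (M : OrliczFunction)
    (hM : ¬ M.IsDegenerate) (p : ℝ≥0∞) [hp1 : Fact (1 ≤ p)]
    (hp : p ∈ Set.Icc M.lowerIndex M.upperIndex) :
    ∃ f : ℕ → OrliczSpace 𝕜 M, IsBlockSequence f ∧
      EquivalentSequences 𝕜 f (lpUnitVector 𝕜 p) := by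
  have hne : ∀ l : List ℝ≥0, 1 ≤ (l.map fun v => M (1 * v)).sum → l ≠ [] := by
    rintro _ h rfl
    simp at h
  rcases eq_or_ne p ∞ with rfl | hptop
  · choose l hl1 hl2 using fun n : ℕ => M.exists_sup_block hM (top_le_iff.mp hp.2)
      (ε := 2⁻¹ ^ (n + 1)) (by positivity)
    obtain ⟨f, hf, hmod⟩ := exists_blockSequence 𝕜 M l fun n => hne _ (hl1 n)
    refine ⟨f, hf, hf.disjointlySupported.equivalent_lp_top (fun n => ?_) (fun n => ?_)⟩
    · rw [hmod]; exact_mod_cast hl1 n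
    · rw [hmod, ENNReal.coe_le_coe]; exact hl2 n
  · have e : ENNReal.ofReal p.toReal = p := ENNReal.ofReal_toReal hptop
    have hpr : 1 ≤ p.toReal := by
      rw [← ENNReal.toReal_one]
      exact ENNReal.toReal_mono hptop hp1.out
    choose l hl1 hl2 using fun n : ℕ => M.exists_power_block hM hpr (by rw [e]; exact hp.1)
      (by rw [e]; exact hp.2) (ε := 2⁻¹ ^ (n + 1)) (by positivity)
    obtain ⟨f, hf, hmod⟩ := exists_blockSequence 𝕜 M l fun n => hne _ (hl1 n)
    exact ⟨f, hf, hf.disjointlySupported.equivalent_lp hptop hmod hl1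
      (fun n x hx => (hl2 n x hx).1) (fun n x hx => (hl2 n x hx).2)⟩

end OrliczSpace

/-! ### Necessity: testing on sums of `N` vectors -/

theorem not_forall_rpow_le_mul_rpow {s t : ℝ} (hts : t < s) (D : ℝ) :
    ¬ ∀ N : ℕ, 0 < N → (N : ℝ) ^ s ≤ D * (N : ℝ) ^ t := by
  intro h
  have hlim := (tendsto_rpow_atTop (sub_pos.mpr hts)).comp tendsto_natCast_atTop_atTop
  obtain ⟨N, hN, hN0⟩ := ((hlim.eventually_gt_atTop D).and
    (Filter.eventually_gt_atTop (0 : ℕ))).exists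
  have hN' : (0 : ℝ) < N := by exact_mod_cast hN0
  simp only [Function.comp_apply] at hN
  rw [Real.rpow_sub hN', lt_div_iff₀ (by positivity)] at hN
  exact hN.not_ge (h N hN0)

/-- The coefficients `1, …, 1, 0, 0, …` with `N` ones. -/
noncomputable def initialOnes (𝕜 : Type*) [RCLike 𝕜] (N : ℕ) : ℕ →₀ 𝕜 :=
  Finsupp.onFinset (Finset.range N) (fun n => if n < N then 1 else 0) fun n h => by
    simpa using h

section initialOnes

variable {𝕜 : Type*} [RCLike 𝕜]

theorem initialOnes_support (N : ℕ) : (initialOnes 𝕜 N).support = Finset.range N := by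
  ext n
  simp [initialOnes]

theorem initialOnes_apply {N n : ℕ} (h : n ∈ Finset.range N) : initialOnes 𝕜 N n = 1 := by
  simpa [initialOnes] using h

theorem norm_lpUnitVector_initialOnes {p : ℝ≥0∞} [Fact (1 ≤ p)] (hp : p ≠ ∞) (N : ℕ) :
    ‖(initialOnes 𝕜 N).sum fun n c => c • lpUnitVector 𝕜 p n‖ = (N : ℝ) ^ p.toReal⁻¹ := by
  have hp0 : 0 < p.toReal :=
    ENNReal.toReal_pos (zero_lt_one.trans_le (Fact.out : 1 ≤ p)).ne' hp
  have h := norm_lpUnitVector_sum_rpow hp (initialOnes 𝕜 N)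
  rw [Real.eq_rpow_inv (norm_nonneg _) N.cast_nonneg hp0.ne', h, initialOnes_support,
    Finset.sum_congr rfl fun n hn => by rw [initialOnes_apply hn, norm_one, Real.one_rpow]]
  simp

/-- The conventions `∞.toReal = 0` and `0⁻¹ = 0` make the right side `1` for `p = ∞`, so this case
needs no separate treatment in `DisjointlySupported.le_upperIndex`. -/
theorem norm_lpUnitVector_initialOnes_le {p : ℝ≥0∞} [Fact (1 ≤ p)] (N : ℕ) :
    ‖(initialOnes 𝕜 N).sum fun n c => c • lpUnitVector 𝕜 p n‖ ≤ (N : ℝ) ^ p.toReal⁻¹ := by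
  rcases eq_or_ne p ∞ with rfl | hp
  · rw [ENNReal.toReal_top, inv_zero, Real.rpow_zero]
    refine norm_lpUnitVector_top_sum_le _ zero_le_one fun n => ?_
    by_cases hn : n < N <;> simp [initialOnes, hn]
  · exact (norm_lpUnitVector_initialOnes hp N).le

end initialOnes

namespace OrliczSpace

variable {𝕜 : Type*} [RCLike 𝕜] {M : OrliczFunction}

theorem DisjointlySupported.modularAt_initialOnes {f : ℕ → OrliczSpace 𝕜 M}
    (hf : DisjointlySupported f) (N : ℕ) (x : ℝ≥0) :
    ((initialOnes 𝕜 N).sum fun n c => c • f n).modularAt x =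
      ∑ n ∈ Finset.range N, (f n).modularAt x := by
  rw [hf.modularAt_sum, initialOnes_support]
  exact Finset.sum_congr rfl fun n hn => by rw [initialOnes_apply hn, nnnorm_one, mul_one]

theorem norm_bounds_of_equivalent {p : ℝ≥0∞} [Fact (1 ≤ p)] {f : ℕ → OrliczSpace 𝕜 M}
    (h : EquivalentSequences 𝕜 f (lpUnitVector 𝕜 p)) : ∃ C : ℝ≥0, 1 ≤ C ∧
      (∀ n, ‖f n‖ ≤ C ∧ 1 ≤ C * ‖f n‖) ∧ ∀ a : ℕ →₀ 𝕜,
        ‖a.sum fun j c => c • f j‖ ≤ C * ‖a.sum fun j c => c • lpUnitVector 𝕜 p j‖ ∧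
        ‖a.sum fun j c => c • lpUnitVector 𝕜 p j‖ ≤ C * ‖a.sum fun j c => c • f j‖ := by
  obtain ⟨C, hC⟩ := h
  have key : ∀ a : ℕ →₀ 𝕜,
      ‖a.sum fun j c => c • f j‖ ≤
        (max C.toNNReal 1 : ℝ≥0) * ‖a.sum fun j c => c • lpUnitVector 𝕜 p j‖ ∧
      ‖a.sum fun j c => c • lpUnitVector 𝕜 p j‖ ≤
        (max C.toNNReal 1 : ℝ≥0) * ‖a.sum fun j c => c • f j‖ := fun a => by
    have hle : C ≤ (max C.toNNReal 1 : ℝ≥0) :=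
      (Real.le_coe_toNNReal C).trans (NNReal.coe_le_coe.mpr (le_max_left _ _))
    exact ⟨(hC a).1.trans (by gcongr), (hC a).2.trans (by gcongr)⟩
  refine ⟨max C.toNNReal 1, le_max_right _ _, fun n => ?_, key⟩
  have h1 := key (Finsupp.single n 1)
  simpa [Finsupp.sum_single_index, norm_lpUnitVector] using h1

theorem DisjointlySupported.lowerIndex_le (hM : ¬ M.IsDegenerate) {p : ℝ≥0∞} [Fact (1 ≤ p)]
    {f : ℕ → OrliczSpace 𝕜 M} (hf : DisjointlySupported f)
    (h : EquivalentSequences 𝕜 f (lpUnitVector 𝕜 p)) : M.lowerIndex ≤ p := by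
  by_contra! hp
  obtain ⟨q, K, hpq, hq, hK⟩ := M.exists_of_lt_lowerIndex hM hp
  obtain ⟨C, hC1, hfn, hfa⟩ := norm_bounds_of_equivalent h
  have hptop : p ≠ ∞ := hp.ne_top
  have hp0 : 0 < p.toReal :=
    ENNReal.toReal_pos (zero_lt_one.trans_le (Fact.out : 1 ≤ p)).ne' hptop
  have hpq' : p.toReal < q := (ENNReal.toReal_lt_toReal hptop ENNReal.coe_ne_top).mpr hpq
  have hq0 : (0 : ℝ) < q := hp0.trans hpq'
  have hC0 : 0 < C + 1 := by positivity
  -- Scaling by `(C + 1)⁻¹` gives modular at most `1`, hence coordinates at most `1`, where the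
  -- power estimate for `M` applies termwise.
  have hmod : ∀ n, ∀ x : ℝ≥0, 0 < x → x ≤ 1 →
      (f n).modularAt (x * (C + 1)⁻¹) ≤ ((K + 1) * x ^ (q : ℝ) : ℝ≥0) := by
    intro n x hx0 hx1
    have h1 : (f n).modularAt (C + 1)⁻¹ ≤ 1 := modularAt_le_one_of_norm_lt _
      ((hfn n).1.trans_lt (NNReal.coe_lt_coe.mpr (lt_add_one C)))
    calc (f n).modularAt (x * (C + 1)⁻¹)
        ≤ ∑' j, (((K + 1) * x ^ (q : ℝ) : ℝ≥0) : ℝ≥0∞) *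
            (M ((C + 1)⁻¹ * ‖(f n).coord j‖₊) : ℝ≥0∞) := by
          refine ENNReal.tsum_le_tsum fun j => ?_
          rw [← ENNReal.coe_mul, ENNReal.coe_le_coe, mul_assoc, mul_comm x]
          have h2 : M ((C + 1)⁻¹ * ‖(f n).coord j‖₊) ≤ 1 :=
            ENNReal.coe_le_one_iff.mp ((ENNReal.le_tsum j).trans h1)
          rcases eq_or_ne ((C + 1)⁻¹ * ‖(f n).coord j‖₊) 0 with h0 | h0
          · rw [h0, zero_mul, M.map_zero']
            exact zero_le
          · refine (hK _ x (pos_iff_ne_zero.mpr h0) (M.le_one_of_map_le_one h2) hx0 hx1).trans ?_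
            gcongr
            exact le_self_add
      _ ≤ (((K + 1) * x ^ (q : ℝ) : ℝ≥0) : ℝ≥0∞) * 1 := by
          rw [ENNReal.tsum_mul_left]
          gcongr
          exact h1
      _ = _ := mul_one _
  refine not_forall_rpow_le_mul_rpow (s := p.toReal⁻¹) (t := (q : ℝ)⁻¹) (by gcongr)
    (C * (C + 1) * (K + 1) ^ (q : ℝ)⁻¹) fun N hN => ?_
  have hN1 : (1 : ℝ≥0) ≤ N := by exact_mod_cast hN
  -- Solves `N * (K + 1) * y ^ (-q) = 1`, so the modular of the sum of `N` vectors, scaled by `(C +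
  -- 1) * y`, is at most `1`. Using `K + 1` keeps `y` positive.
  set y : ℝ≥0 := ((K + 1) * N) ^ (q : ℝ)⁻¹ with hy
  have hy1 : 1 ≤ y := NNReal.one_le_rpow (one_le_mul_of_one_le_of_one_le le_add_self hN1)
    (by positivity)
  have hy0 : 0 < y := zero_lt_one.trans_le hy1
  have hyq : y ^ (q : ℝ) = (K + 1) * N := by
    rw [hy, ← NNReal.rpow_mul, inv_mul_cancel₀ hq0.ne', NNReal.rpow_one]
  have hnorm : ‖(initialOnes 𝕜 N).sum fun n c => c • f n‖ ≤ ((C + 1) * y : ℝ≥0) := by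
    refine norm_le_of_modularAt_le_one _ (by positivity) ?_
    rw [hf.modularAt_initialOnes, mul_inv, mul_comm]
    refine (Finset.sum_le_sum fun n _ => hmod n y⁻¹ (by positivity)
      (inv_le_one_of_one_le₀ hy1)).trans ?_
    rw [Finset.sum_const, Finset.card_range, NNReal.inv_rpow, hyq, nsmul_eq_mul,
      ← ENNReal.coe_natCast, ← ENNReal.coe_mul, ENNReal.coe_le_one_iff]
    have : (N : ℝ≥0) ≠ 0 := (zero_lt_one.trans_le hN1).ne'
    refine le_of_eq ?_
    field_simp
  have h1 := (hfa (initialOnes 𝕜 N)).2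
  rw [norm_lpUnitVector_initialOnes hptop] at h1
  calc (N : ℝ) ^ p.toReal⁻¹ ≤ C * ((C + 1) * y : ℝ≥0) := h1.trans (by gcongr)
    _ = _ := by
      rw [hy, NNReal.mul_rpow]
      push_cast
      ring

theorem DisjointlySupported.le_upperIndex (hM : ¬ M.IsDegenerate) {p : ℝ≥0∞} [Fact (1 ≤ p)]
    {f : ℕ → OrliczSpace 𝕜 M} (hf : DisjointlySupported f)
    (h : EquivalentSequences 𝕜 f (lpUnitVector 𝕜 p)) : p ≤ M.upperIndex := by
  by_contra! hp
  obtain ⟨q, c, hqp, hq, hc0, hc⟩ := M.exists_of_upperIndex_lt hM hp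
  obtain ⟨C, hC1, hfn, hfa⟩ := norm_bounds_of_equivalent h
  have hC0 : 0 < C := zero_lt_one.trans_le hC1
  have hq0 : (0 : ℝ) < q := NNReal.coe_pos.mpr (zero_lt_one.trans_le hq)
  have hqp' : p.toReal⁻¹ * q < 1 := by
    rcases eq_or_ne p ∞ with rfl | hptop
    · simp
    · have h1 : (q : ℝ) < p.toReal := (ENNReal.toReal_lt_toReal ENNReal.coe_ne_top hptop).mpr hqp
      rw [inv_mul_lt_iff₀ (hq0.trans h1), mul_one]
      exact h1
  have hmod : ∀ n, ∀ x : ℝ≥0, 0 < x → x ≤ 1 →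
      ((c * x ^ (q : ℝ) : ℝ≥0) : ℝ≥0∞) ≤ (f n).modularAt (x * (2 * C)) := by
    intro n x hx0 hx1
    have h1 : 1 ≤ (f n).modularAt (2 * C) := by
      by_contra! hlt
      have h2 := (f n).norm_le_of_modularAt_le_one (t := (2 * C)⁻¹) (by positivity)
        (by rw [inv_inv]; exact hlt.le)
      have h3 := (hfn n).2
      have hC0' : (0 : ℝ) < C := hC0
      have h4 : (C : ℝ) * ‖f n‖ ≤ C * ((2 * C)⁻¹ : ℝ≥0) := by gcongr
      have h5 : (C : ℝ) * ((2 * C)⁻¹ : ℝ≥0) = 2⁻¹ := by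
        push_cast
        field_simp
      rw [h5] at h4
      norm_num at h4
      linarith
    -- The power estimate covers only dilations `b ≤ 1`. If some scaled coordinate exceeds `1`, that
    -- coordinate alone suffices, by the estimate at `b = 1` and monotonicity.
    by_cases hall : ∀ j, 2 * C * ‖(f n).coord j‖₊ ≤ 1
    · calc ((c * x ^ (q : ℝ) : ℝ≥0) : ℝ≥0∞)
          ≤ ((c * x ^ (q : ℝ) : ℝ≥0) : ℝ≥0∞) * (f n).modularAt (2 * C) :=
            le_mul_of_one_le_right zero_le h1
        _ ≤ _ := by
          rw [modularAt, ← ENNReal.tsum_mul_left]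
          refine ENNReal.tsum_le_tsum fun j => ?_
          rw [← ENNReal.coe_mul, ENNReal.coe_le_coe, mul_assoc x, mul_comm x]
          rcases eq_or_ne (2 * C * ‖(f n).coord j‖₊) 0 with h0 | h0
          · rw [h0, M.map_zero', mul_zero]
            exact zero_le
          · exact hc _ x (pos_iff_ne_zero.mpr h0) (hall j) hx0 hx1
    · push Not at hall
      obtain ⟨j, hj⟩ := hall
      refine le_trans ?_ (ENNReal.le_tsum j)
      rw [ENNReal.coe_le_coe]
      calc c * x ^ (q : ℝ) = c * x ^ (q : ℝ) * M 1 := by rw [M.map_one', mul_one]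
        _ ≤ M (1 * x) := hc 1 x one_pos le_rfl hx0 hx1
        _ ≤ _ := M.mono (by rw [one_mul, mul_assoc]; exact le_mul_of_one_le_right zero_le hj.le)
  refine not_forall_rpow_le_mul_rpow hqp' (c⁻¹ * (4 * C * C) ^ (q : ℝ)) fun N hN => ?_
  have hN1 : (1 : ℝ≥0) ≤ N := by exact_mod_cast hN
  have hN0 : (0 : ℝ≥0) < N := zero_lt_one.trans_le hN1
  set R : ℝ≥0 := 2 * C * (N : ℝ≥0) ^ p.toReal⁻¹ with hR
  have hNp : (1 : ℝ≥0) ≤ (N : ℝ≥0) ^ p.toReal⁻¹ := NNReal.one_le_rpow hN1 (by positivity)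
  have hR0 : 0 < R := by positivity
  have hlt : ‖(initialOnes 𝕜 N).sum fun n c => c • f n‖ < R := by
    have h1 := (hfa (initialOnes 𝕜 N)).1
    have h2 := norm_lpUnitVector_initialOnes_le (𝕜 := 𝕜) (p := p) N
    have hpos : (0 : ℝ) < C * (N : ℝ) ^ p.toReal⁻¹ := by positivity
    have h3 : (C : ℝ) * ‖(initialOnes 𝕜 N).sum fun n c => c • lpUnitVector 𝕜 p n‖ ≤
        C * (N : ℝ) ^ p.toReal⁻¹ := by gcongr
    rw [hR]
    push_cast
    linarith
  have hm := modularAt_le_one_of_norm_lt _ hlt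
  have hx1 : (2 * C * R)⁻¹ ≤ 1 := inv_le_one_of_one_le₀
    (one_le_mul_of_one_le_of_one_le (one_le_mul_of_one_le_of_one_le (by norm_num) hC1)
      (one_le_mul_of_one_le_of_one_le (one_le_mul_of_one_le_of_one_le (by norm_num) hC1) hNp))
  -- Each of the `N` vectors contributes at least `c * (2 * C * R)⁻¹ ^ q` to a modular bounded by
  -- `1`; as `R` is a multiple of `N ^ (1 / p)`, this bounds `N` by a multiple of `N ^ (q / p)`.
  have hsum : ((N * (c * ((2 * C * R)⁻¹) ^ (q : ℝ)) : ℝ≥0) : ℝ≥0∞) ≤ 1 := by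
    refine le_trans ?_ hm
    rw [hf.modularAt_initialOnes, ENNReal.coe_mul, ENNReal.coe_natCast]
    have e : (2 * C * R)⁻¹ * (2 * C) = R⁻¹ := by field_simp
    calc (N : ℝ≥0∞) * ((c * ((2 * C * R)⁻¹) ^ (q : ℝ) : ℝ≥0) : ℝ≥0∞)
        = ∑ n ∈ Finset.range N, ((c * ((2 * C * R)⁻¹) ^ (q : ℝ) : ℝ≥0) : ℝ≥0∞) := by
          rw [Finset.sum_const, Finset.card_range, nsmul_eq_mul]
      _ ≤ _ := Finset.sum_le_sum fun n _ => by
          rw [← e]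
          exact hmod n _ (by positivity) hx1
  rw [ENNReal.coe_le_one_iff] at hsum
  have h1 : (N : ℝ≥0) ≤ c⁻¹ * (2 * C * R) ^ (q : ℝ) := by
    have hpos : 0 < (2 * C * R) ^ (q : ℝ) := NNReal.rpow_pos (by positivity)
    rw [NNReal.inv_rpow, ← mul_assoc, ← div_eq_mul_inv, div_le_one hpos] at hsum
    rwa [← div_eq_inv_mul, le_div_iff₀ hc0]
  have h2 : c⁻¹ * (2 * C * R) ^ (q : ℝ) =
      c⁻¹ * (4 * C * C) ^ (q : ℝ) * (N : ℝ≥0) ^ (p.toReal⁻¹ * q) := by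
    rw [hR, show 2 * C * (2 * C * (N : ℝ≥0) ^ p.toReal⁻¹) =
      (4 * C * C) * (N : ℝ≥0) ^ p.toReal⁻¹ by ring, NNReal.mul_rpow, ← NNReal.rpow_mul]
    exact (mul_assoc _ _ _).symm
  rw [h2, ← NNReal.coe_le_coe] at h1
  push_cast at h1
  rw [Real.rpow_one]
  exact h1

end OrliczSpace

theorem mainTheorem6 (𝕜 : Type*) [RCLike 𝕜] (M : OrliczFunction) (hM : ¬ M.IsDegenerate)
    (p : ℝ≥0∞) [Fact (1 ≤ p)] :
    List.TFAE [
      p ∈ Set.Icc M.lowerIndex M.upperIndex,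
      ∃ f : ℕ → OrliczSpace 𝕜 M, OrliczSpace.DisjointlySupported f ∧
        EquivalentSequences 𝕜 f (lpUnitVector 𝕜 p),
      ∃ f : ℕ → OrliczSpace 𝕜 M, OrliczSpace.IsBlockSequence f ∧
        EquivalentSequences 𝕜 f (lpUnitVector 𝕜 p)] := by
  tfae_have 1 → 3 := OrliczSpace.exists_blockSequence_equivalent_lp 𝕜 M hM p
  tfae_have 3 → 2 := fun ⟨f, hf, h⟩ => ⟨f, hf.disjointlySupported, h⟩
  tfae_have 2 → 1 := fun ⟨_, hf, h⟩ => ⟨hf.lowerIndex_le hM h, hf.le_upperIndex hM h⟩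
  tfae_finish
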